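/- **Proposition (Existence of the extended form).** Let $(X,\mathfrak A,\mu)$ be a $\sigma$-finite measure space, and let $L^0(X,\mu)$ be the space of $\mu$-a.e. classes of measurable functions $X\to\mathbb R$, with the topology of local convergence in measure, given by the metric $\|f-g\|_0$ where $\|f\|_0=\int_X(|f|\wedge 1)\,\varphi\,d\mu$ for some (any) integrable $\varphi\colon X\to(0,\infty)$. For $p\in\{0,2\}$, a quadratic form on $L^p(X,\mu)$ is a map $q\colon L^p(X,\mu)\to[0,\infty]$ with $q(cf)=c^2q(f)$ for $c\in\mathbb R$ (where $0\cdot\infty=0$) and $q(f+g)+q(f-g)=2q(f)+2q(g)$. Its domain is $D(q)=\{f: q(f)<\infty\}$. It is closed if $D(q)$ is complete with respect to the metric $d_q(f,g)=q(f-g)^{1/2}+\|f-g\|_p$. A form $q'$ extends $q$ if $D(q)\subseteq D(q')$ and $q'=q$ on $D(q)$. The form $q$ is closable if it has a closed extension, and its closure is the smallest closed extension (the one of which every closed extension of $q$ is an extension). It satisfies the first Beurling–Deny criterion if $q(|f|)\le q(f)$ for all $f\in L^p(X,\mu)$. A function $h\in L^0(X,\mu)$ (with $h_-\in L^2(X,\mu)$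 if $p=2$) is $q$-excessive if $q(f\wedge h)\le q(f)$ for all $f\in L^p(X,\mu)$. Let $q$ be a closed quadratic form on $L^2(X,\mu)$ satisfying the first Beurling–Deny criterion (it need not be densely defined), and regard it as a quadratic form on $L^0(X,\mu)$ by setting $q(f)=\infty$ for $f\in L^0(X,\mu)\setminus L^2(X,\mu)$. Then $q$ is closable on $L^0(X,\mu)$. Its closure $q_e$ exists and is a quadratic form on $L^0(X,\mu)$ satisfying the first Beurling–Deny criterion. Moreover, $D(q_e)\cap L^2(X,\mu)=D(q)$, and a nonnegative function $h\in L^0(X,\mu)$ is $q$-excessive if and only if it is $q_e$-excessive. -/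

import Mathlib

open MeasureTheory Filter Topology
open scoped ENNReal

/-! ### Quadratic forms with values in `[0, ∞]` -/

section Forms

variable {E : Type*} [AddCommGroup E] [Module ℝ E]

/-- `q : E → [0, ∞]` is a quadratic form: `q (c f) = c² q f` (with `0 * ∞ = 0`) and the
parallelogram identity holds. -/
structure IsQuadForm (q : E → ℝ≥0∞) : Prop where
  smul : ∀ (c : ℝ) (f : E), q (c • f) = ENNReal.ofReal (c ^ 2) * q f
  parallelogram : ∀ f g : E, q (f + g) + q (f - g) = 2 * q f + 2 * q g

/-- The domain `D(q) = {f | q f < ∞}`. -/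
def formDomain (q : E → ℝ≥0∞) : Set E := {f | q f < ∞}

/-- The form metric `d_q(f, g) = q(f - g)^{1/2} + N(f - g)`, where `N` is the (F-)norm of the
underlying space. -/
noncomputable def formDist (N q : E → ℝ≥0∞) (f g : E) : ℝ≥0∞ :=
  q (f - g) ^ (1 / 2 : ℝ) + N (f - g)

/-- `q` is closed: its domain is complete with respect to the form metric. -/
def IsClosedForm (N q : E → ℝ≥0∞) : Prop :=
  ∀ u : ℕ → E, (∀ n, u n ∈ formDomain q) →
    (∀ ε : ℝ≥0∞, 0 < ε → ∃ K : ℕ, ∀ m ≥ K, ∀ n ≥ K, formDist N q (u m) (u n) < ε) →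
    ∃ f ∈ formDomain q, Tendsto (fun n => formDist N q (u n) f) atTop (𝓝 0)

/-- `q'` is an extension of `q`: `D(q) ⊆ D(q')` and `q' = q` on `D(q)`. -/
def IsFormExtension (q q' : E → ℝ≥0∞) : Prop :=
  formDomain q ⊆ formDomain q' ∧ Set.EqOn q' q (formDomain q)

/-- `q'` is a closed quadratic form extending `q`. -/
structure IsClosedFormExtension (N q q' : E → ℝ≥0∞) : Prop where
  isQuadForm : IsQuadForm q'
  isClosedForm : IsClosedForm N q'
  isFormExtension : IsFormExtension q q'

/-- `q` is closable: it possesses a closed extension. -/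
def IsClosableForm (N q : E → ℝ≥0∞) : Prop :=
  ∃ q' : E → ℝ≥0∞, IsClosedFormExtension N q q'

/-- `qe` is the closure of `q`: the smallest closed extension of `q`. -/
structure IsFormClosure (N q qe : E → ℝ≥0∞) : Prop where
  isClosedFormExtension : IsClosedFormExtension N q qe
  smallest : ∀ q' : E → ℝ≥0∞, IsClosedFormExtension N q q' → IsFormExtension qe q'

/-- The first Beurling–Deny criterion: `q |f| ≤ q f` for all `f`. -/
def FirstBeurlingDeny [Lattice E] (q : E → ℝ≥0∞) : Prop :=
  ∀ f : E, q |f| ≤ q f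

end Forms

/-! ### Forms on `L²` and on `L⁰` -/

section Spaces

variable {X : Type*} [MeasurableSpace X] {μ : Measure X}

/-- The norm of `L²(X, μ)`. -/
noncomputable def normL2 (f : Lp ℝ 2 μ) : ℝ≥0∞ := ‖f‖ₑ

/-- The F-norm `∫ (|f| ∧ 1) φ dμ` on `L⁰(X, μ)`; for strictly positive integrable `φ` it induces
the topology of local convergence in measure. -/
noncomputable def normL0 (φ : X → ℝ) (f : X →ₘ[μ] ℝ) : ℝ≥0∞ :=
  ∫⁻ x, ENNReal.ofReal (min |f x| 1 * φ x) ∂μ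

open Classical in
/-- A form on `L²` regarded as a form on `L⁰`, with value `∞` off `L²`. -/
noncomputable def formOnL0 (q : Lp ℝ 2 μ → ℝ≥0∞) (f : X →ₘ[μ] ℝ) : ℝ≥0∞ :=
  if hf : f ∈ Lp ℝ 2 μ then q ⟨f, hf⟩ else ∞

theorem inf_mem_L2 {h : X →ₘ[μ] ℝ} (hh : h⁻ ∈ Lp ℝ 2 μ) (f : Lp ℝ 2 μ) :
    (f : X →ₘ[μ] ℝ) ⊓ h ∈ Lp ℝ 2 μ := by
  have key : (f : X →ₘ[μ] ℝ) ⊓ h ∈ Lp ℝ 2 μ ↔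
      MemLp ((f : X →ₘ[μ] ℝ) ⊓ h : X →ₘ[μ] ℝ) 2 μ := Lp.mem_Lp_iff_memLp
  rw [key]
  refine ((Lp.memLp f).norm.add (Lp.memLp ⟨h⁻, hh⟩).norm).mono
    (AEEqFun.aestronglyMeasurable _) ?_
  have h1 : ⇑(h⁻) =ᵐ[μ] fun x => (-h) x ⊔ (0 : X →ₘ[μ] ℝ) x := AEEqFun.coeFn_sup (-h) 0
  filter_upwards [AEEqFun.coeFn_inf (f : X →ₘ[μ] ℝ) h, h1, AEEqFun.coeFn_neg h,
    AEEqFun.coeFn_zero (α := X) (μ := μ) (β := ℝ)] with x h2 h3 h4 h5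
  simp only [Pi.add_apply, Real.norm_eq_abs, h2, h3, h4, h5, Pi.neg_apply, Pi.zero_apply]
  rcases le_total ((f : X →ₘ[μ] ℝ) x) (h x) with h6 | h6 <;>
  rcases le_total (h x) 0 with h7 | h7 <;>
  simp only [abs_le, inf_of_le_left, inf_of_le_right, h6]
  all_goals
    rw [abs_of_nonneg (a := |(f : X →ₘ[μ] ℝ) x| + |-h x ⊔ 0|) (by positivity)]
    have h8 := neg_abs_le ((f : X →ₘ[μ] ℝ) x)
    have h9 := le_abs_self ((f : X →ₘ[μ] ℝ) x)
    have h10 := le_abs_self (-h x ⊔ 0)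
    have h11 := le_sup_left (a := -h x) (b := 0)
    have h12 := abs_nonneg (-h x ⊔ 0)
    constructor <;> linarith

/-- `h ∈ L⁰` is excessive for a form `q` on `L²`: `h⁻ ∈ L²` (so that `f ∧ h ∈ L²` for all
`f ∈ L²`) and `q (f ∧ h) ≤ q f` for all `f ∈ L²`. -/
def IsExcessiveL2 (q : Lp ℝ 2 μ → ℝ≥0∞) (h : X →ₘ[μ] ℝ) : Prop :=
  ∃ hh : h⁻ ∈ Lp ℝ 2 μ, ∀ f : Lp ℝ 2 μ, q ⟨(f : X →ₘ[μ] ℝ) ⊓ h, inf_mem_L2 hh f⟩ ≤ q f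

/-- `h ∈ L⁰` is excessive for a form `q` on `L⁰`: `q (f ∧ h) ≤ q f` for all `f ∈ L⁰`. -/
def IsExcessiveL0 (q : (X →ₘ[μ] ℝ) → ℝ≥0∞) (h : X →ₘ[μ] ℝ) : Prop :=
  ∀ f : X →ₘ[μ] ℝ, q (f ⊓ h) ≤ q f

end Spaces

/-! The extended form is the lower semicontinuous envelope `lscEnvelope` of `formOnL0 q` for local
convergence in measure. Everything hinges on `formOnL0_le_of_aetendsto`: on `L²`, `q` is lower
semicontinuous even along sequences that converge only almost everywhere.

For that, a closed form is lower semicontinuous in `L²`, hence along dominated a.e. convergence, and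
so form-bounded dominated null sequences tend weakly to zero for the form. Domination is removed for
nonnegative sequences by a lattice argument: if `q(f, u n) > δ` infinitely often, joining
well-chosen terms produces `U` with `q U ≤ N * C` but `q(f, U) ≥ N * δ / 2`, against Cauchy–Schwarz
for large `N`. The energy grows only linearly because `q (u ⊓ U) + q (u ⊔ U) ≤ q u + q U`, and the
pairing grows because `u n ⊓ U` is dominated by `U`. Splitting `u n - f` into positive and negative
parts and expanding `q (f + (u n - f))` then gives the bound.

Consequently the envelope equals `q` on all of `L²`. It is a quadratic form, and it is closed since
`L⁰` is complete. It is the smallest closed extension because each element of its domain is the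
limit of a `q`-Cauchy sequence, along which every closed extension takes the same value. Finally,
pointwise contractions such as `|·|` and `· ⊓ h` that do not increase `q` do not increase the
envelope. -/

/-! ### Quadratic forms: polarization and the triangle inequality -/

section QuadForm

variable {E : Type*} [AddCommGroup E]

/-- The polarization of a form, meaningful on its domain. -/
noncomputable def formPolar (q : E → ℝ≥0∞) (f g : E) : ℝ :=
  ((q (f + g)).toReal - (q f).toReal - (q g).toReal) / 2

theorem formPolar_comm (q : E → ℝ≥0∞) (f g : E) : formPolar q f g = formPolar q g f := by
  unfold formPolar
  rw [add_comm f g]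
  ring

/-- A rearrangement of the definition, valid even at infinite values because `toReal` sends `∞` to
`0`. -/
theorem toReal_form_add (q : E → ℝ≥0∞) (f g : E) :
    (q (f + g)).toReal = (q f).toReal + 2 * formPolar q f g + (q g).toReal := by
  unfold formPolar
  ring

/-- Subadditive, even, definite functionals with values in `[0, ∞]`. -/
structure IsFNorm (N : E → ℝ≥0∞) : Prop where
  map_zero : N 0 = 0
  add_le : ∀ f g : E, N (f + g) ≤ N f + N g
  map_neg : ∀ f : E, N (-f) = N f
  eq_zero : ∀ f : E, N f = 0 → f = 0

theorem IsFNorm.sub_le {N : E → ℝ≥0∞} (hN : IsFNorm N) (f g h : E) :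
    N (f - h) ≤ N (f - g) + N (g - h) := by
  simpa using hN.add_le (f - g) (g - h)

theorem IsFNorm.map_sub_comm {N : E → ℝ≥0∞} (hN : IsFNorm N) (f g : E) :
    N (f - g) = N (g - f) := by
  rw [← hN.map_neg, neg_sub]

/-- A sequence in the domain of a closed form that is Cauchy for the form and converges to `f` in
the underlying space converges to `f` in the form metric. -/
theorem IsClosedForm.tendsto_of_cauchy {N q : E → ℝ≥0∞} (hcl : IsClosedForm N q) (hN : IsFNorm N)
    {u : ℕ → E} (hu : ∀ n, q (u n) ≠ ∞)
    (hcau : ∀ ε : ℝ≥0∞, 0 < ε → ∃ M : ℕ, ∀ m ≥ M, ∀ n ≥ M, q (u m - u n) < ε) {f : E}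
    (hf : Tendsto (fun n => N (u n - f)) atTop (𝓝 0)) :
    q f ≠ ∞ ∧ Tendsto (fun n => q (u n - f) ^ (1 / 2 : ℝ)) atTop (𝓝 0) := by
  obtain ⟨g, hg, hlim⟩ := hcl u (fun n => (hu n).lt_top) fun ε hε => by
    have hε2 : 0 < ε / 2 := ENNReal.half_pos hε.ne'
    have hε4 : 0 < ε / 2 / 2 := ENNReal.half_pos hε2.ne'
    -- The threshold is squared because the form metric takes the square root of `q`.
    obtain ⟨M₁, hM₁⟩ := hcau ((ε / 2) ^ (2 : ℝ)) (ENNReal.rpow_pos_of_nonneg hε2 (by norm_num))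
    obtain ⟨M₂, hM₂⟩ := eventually_atTop.1 (hf.eventually_lt_const hε4)
    refine ⟨max M₁ M₂, fun m hm n hn => ?_⟩
    have h1 := hM₁ m (le_of_max_le_left hm) n (le_of_max_le_left hn)
    have h2 := ENNReal.rpow_lt_rpow h1 (show (0 : ℝ) < 1 / 2 by norm_num)
    rw [← ENNReal.rpow_mul] at h2
    norm_num at h2
    have h3 : N (u m - u n) < ε / 2 := by
      calc N (u m - u n) ≤ N (u m - f) + N (f - u n) := hN.sub_le _ _ _
        _ < ε / 2 / 2 + ε / 2 / 2 := by
          rw [hN.map_sub_comm f]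
          exact ENNReal.add_lt_add (hM₂ m (le_of_max_le_right hm))
            (hM₂ n (le_of_max_le_right hn))
        _ = ε / 2 := ENNReal.add_halves _
    calc formDist N q (u m) (u n) < ε / 2 + ε / 2 := by
          refine ENNReal.add_lt_add ?_ h3
          simpa using h2
      _ = ε := ENNReal.add_halves _
  have h1 : Tendsto (fun n => N (u n - g)) atTop (𝓝 0) :=
    tendsto_of_tendsto_of_tendsto_of_le_of_le tendsto_const_nhds hlim (fun _ => zero_le)
      fun n => le_add_self
  have h2 : Tendsto (fun n => q (u n - g) ^ (1 / 2 : ℝ)) atTop (𝓝 0) :=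
    tendsto_of_tendsto_of_tendsto_of_le_of_le tendsto_const_nhds hlim (fun _ => zero_le)
      fun n => le_self_add
  have h3 : N (f - g) = 0 := by
    have h4 := hf.add h1
    rw [add_zero] at h4
    refine le_antisymm (ge_of_tendsto' h4 fun n => ?_) zero_le
    rw [hN.map_sub_comm (u n) f]
    exact hN.sub_le _ _ _
  rw [sub_eq_zero.1 (hN.eq_zero _ h3)]
  exact ⟨ne_of_lt hg, h2⟩

variable [Module ℝ E] {q : E → ℝ≥0∞}

namespace IsQuadForm

theorem map_zero (hq : IsQuadForm q) : q 0 = 0 := by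
  simpa using hq.smul 0 0

theorem map_neg (hq : IsQuadForm q) (f : E) : q (-f) = q f := by
  simpa using hq.smul (-1) f

theorem map_sub_comm (hq : IsQuadForm q) (f g : E) : q (f - g) = q (g - f) := by
  rw [← hq.map_neg, neg_sub]

theorem add_le (hq : IsQuadForm q) (f g : E) : q (f + g) ≤ 2 * q f + 2 * q g :=
  hq.parallelogram f g ▸ le_self_add

theorem sub_le (hq : IsQuadForm q) (f g : E) : q (f - g) ≤ 2 * q f + 2 * q g :=
  hq.parallelogram f g ▸ le_add_self

theorem add_ne_top (hq : IsQuadForm q) {f g : E} (hf : q f ≠ ∞) (hg : q g ≠ ∞) :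
    q (f + g) ≠ ∞ :=
  ne_top_of_le_ne_top (by finiteness) (hq.add_le f g)

theorem sub_ne_top (hq : IsQuadForm q) {f g : E} (hf : q f ≠ ∞) (hg : q g ≠ ∞) :
    q (f - g) ≠ ∞ :=
  ne_top_of_le_ne_top (by finiteness) (hq.sub_le f g)

theorem smul_ne_top (hq : IsQuadForm q) (c : ℝ) {f : E} (hf : q f ≠ ∞) : q (c • f) ≠ ∞ := by
  rw [hq.smul]
  finiteness

theorem toReal_smul (hq : IsQuadForm q) (c : ℝ) (f : E) :
    (q (c • f)).toReal = c ^ 2 * (q f).toReal := by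
  rw [hq.smul, ENNReal.toReal_mul, ENNReal.toReal_ofReal (sq_nonneg c)]

theorem toReal_parallelogram (hq : IsQuadForm q) {f g : E} (hf : q f ≠ ∞) (hg : q g ≠ ∞) :
    (q (f + g)).toReal + (q (f - g)).toReal = 2 * (q f).toReal + 2 * (q g).toReal := by
  rw [← ENNReal.toReal_add (hq.add_ne_top hf hg) (hq.sub_ne_top hf hg), hq.parallelogram,
    ENNReal.toReal_add (by finiteness) (by finiteness)]
  simp

/-- Jordan–von Neumann: a linear combination of four parallelogram identities. -/
theorem formPolar_add_right (hq : IsQuadForm q) {f g h : E} (hf : q f ≠ ∞) (hg : q g ≠ ∞)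
    (hh : q h ≠ ∞) : formPolar q f (g + h) = formPolar q f g + formPolar q f h := by
  have h1 := hq.toReal_parallelogram (hq.add_ne_top hf hh) hg
  have h2 := hq.toReal_parallelogram (hq.add_ne_top hf hg) hh
  have h3 := hq.toReal_parallelogram hf (hq.sub_ne_top hg hh)
  have h4 := hq.toReal_parallelogram hg hh
  unfold formPolar
  rw [show f + h + g = f + (g + h) by abel, show f + h - g = f - (g - h) by abel] at h1
  rw [show f + g + h = f + (g + h) by abel, show f + g - h = f + (g - h) by abel] at h2
  linarith

theorem formPolar_neg_right (hq : IsQuadForm q) {f g : E} (hf : q f ≠ ∞) (hg : q g ≠ ∞) :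
    formPolar q f (-g) = -formPolar q f g := by
  have h1 := hq.formPolar_add_right hf hg (hq.map_neg g ▸ hg)
  have h2 : formPolar q f 0 = 0 := by simp [formPolar, hq.map_zero]
  rw [add_neg_cancel, h2] at h1
  linarith

theorem formPolar_neg_left (hq : IsQuadForm q) {f g : E} (hf : q f ≠ ∞) (hg : q g ≠ ∞) :
    formPolar q (-f) g = -formPolar q f g := by
  rw [formPolar_comm, hq.formPolar_neg_right hg hf, formPolar_comm]

theorem formPolar_sub_right (hq : IsQuadForm q) {f g h : E} (hf : q f ≠ ∞) (hg : q g ≠ ∞)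
    (hh : q h ≠ ∞) : formPolar q f (g - h) = formPolar q f g - formPolar q f h := by
  rw [sub_eq_add_neg, hq.formPolar_add_right hf hg (hq.map_neg h ▸ hh),
    hq.formPolar_neg_right hf hh, sub_eq_add_neg]

theorem formPolar_ratCast_smul_right (hq : IsQuadForm q) {f g : E} (hf : q f ≠ ∞) (hg : q g ≠ ∞)
    (r : ℚ) : formPolar q f ((r : ℝ) • g) = r * formPolar q f g := by
  let F : ℝ →+ ℝ := AddMonoidHom.mk' (fun t => formPolar q f (t • g)) fun s t => by
    rw [add_smul]
    exact hq.formPolar_add_right hf (hq.smul_ne_top s hg) (hq.smul_ne_top t hg)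
  have h := map_ratCast_smul F ℝ ℝ r (1 : ℝ)
  simpa [F] using h

/-- Cauchy–Schwarz by the discriminant of `t ↦ q (f + t • g)`. Additivity gives homogeneity of the
polarization for rational `t`, and density of the rationals extends nonnegativity of the quadratic
polynomial to real `t`. -/
theorem formPolar_sq_le (hq : IsQuadForm q) {f g : E} (hf : q f ≠ ∞) (hg : q g ≠ ∞) :
    formPolar q f g ^ 2 ≤ (q f).toReal * (q g).toReal := by
  have key : ∀ t : ℝ, 0 ≤ (q g).toReal * (t * t) + 2 * formPolar q f g * t + (q f).toReal := by
    intro t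
    refine Rat.denseRange_cast.induction_on (p := fun t : ℝ =>
      0 ≤ (q g).toReal * (t * t) + 2 * formPolar q f g * t + (q f).toReal) t
      (isClosed_le continuous_const (by fun_prop)) fun r => ?_
    have h := toReal_form_add q f ((r : ℝ) • g)
    rw [hq.formPolar_ratCast_smul_right hf hg, hq.toReal_smul] at h
    have h0 : 0 ≤ (q (f + (r : ℝ) • g)).toReal := ENNReal.toReal_nonneg
    linarith
  have h := discrim_le_zero key
  unfold discrim at h
  linarith

/-- Weak convergence to zero follows from one-sided bounds on the polarization. -/
theorem tendsto_formPolar_of_eventually_le (hq : IsQuadForm q) {u : ℕ → E} (hu : ∀ n, q (u n) ≠ ∞)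
    (h : ∀ f : E, q f ≠ ∞ → ∀ ε : ℝ, 0 < ε → ∀ᶠ n in atTop, formPolar q f (u n) ≤ ε) {f : E}
    (hf : q f ≠ ∞) : Tendsto (fun n => formPolar q f (u n)) atTop (𝓝 0) := by
  rw [Metric.tendsto_atTop']
  intro ε hε
  have h1 := h f hf (ε / 2) (by positivity)
  -- The upper bound for `-f` is the lower bound for `f`.
  have h2 := h (-f) ((hq.map_neg f).symm ▸ hf) (ε / 2) (by positivity)
  obtain ⟨N, hN⟩ := eventually_atTop.1 (h1.and h2)
  refine ⟨N, fun n hn => ?_⟩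
  obtain ⟨h3, h4⟩ := hN n hn.le
  rw [hq.formPolar_neg_left hf (hu n)] at h4
  rw [Real.dist_eq, sub_zero, abs_lt]
  constructor <;> linarith

theorem sqrt_add_le (hq : IsQuadForm q) (f g : E) :
    q (f + g) ^ (1 / 2 : ℝ) ≤ q f ^ (1 / 2 : ℝ) + q g ^ (1 / 2 : ℝ) := by
  by_cases hf : q f = ∞
  · simp [hf]
  by_cases hg : q g = ∞
  · simp [hg]
  rw [← ENNReal.ofReal_toReal hf, ← ENNReal.ofReal_toReal hg,
    ← ENNReal.ofReal_toReal (hq.add_ne_top hf hg),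
    ENNReal.ofReal_rpow_of_nonneg ENNReal.toReal_nonneg (by norm_num),
    ENNReal.ofReal_rpow_of_nonneg ENNReal.toReal_nonneg (by norm_num),
    ENNReal.ofReal_rpow_of_nonneg ENNReal.toReal_nonneg (by norm_num),
    ← ENNReal.ofReal_add (by positivity) (by positivity), ← Real.sqrt_eq_rpow,
    ← Real.sqrt_eq_rpow, ← Real.sqrt_eq_rpow]
  refine ENNReal.ofReal_le_ofReal (Real.sqrt_le_iff.2 ⟨by positivity, ?_⟩)
  have h1 := Real.abs_le_sqrt (hq.formPolar_sq_le hf hg)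
  rw [Real.sqrt_mul ENNReal.toReal_nonneg] at h1
  have h2 := Real.sq_sqrt (ENNReal.toReal_nonneg (a := q f))
  have h3 := Real.sq_sqrt (ENNReal.toReal_nonneg (a := q g))
  have h4 := le_abs_self (formPolar q f g)
  rw [toReal_form_add]
  nlinarith

/-- Square roots of a form converge along sequences converging in the form seminorm. -/
theorem tendsto_sqrt (hq : IsQuadForm q) {u : ℕ → E} {f : E}
    (h : Tendsto (fun n => q (u n - f) ^ (1 / 2 : ℝ)) atTop (𝓝 0)) :
    Tendsto (fun n => q (u n) ^ (1 / 2 : ℝ)) atTop (𝓝 (q f ^ (1 / 2 : ℝ))) := by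
  have h1 : Tendsto (fun n => q f ^ (1 / 2 : ℝ) + q (u n - f) ^ (1 / 2 : ℝ)) atTop
      (𝓝 (q f ^ (1 / 2 : ℝ))) := by
    simpa using tendsto_const_nhds.add h
  have h2 : Tendsto (fun n => q f ^ (1 / 2 : ℝ) - q (u n - f) ^ (1 / 2 : ℝ)) atTop
      (𝓝 (q f ^ (1 / 2 : ℝ))) := by
    simpa using ENNReal.Tendsto.sub tendsto_const_nhds h (Or.inr ENNReal.zero_ne_top)
  refine tendsto_of_tendsto_of_tendsto_of_le_of_le h2 h1 (fun n => ?_) fun n => ?_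
  · refine tsub_le_iff_right.2 ?_
    have := hq.sqrt_add_le (u n) (f - u n)
    rwa [add_sub_cancel, hq.map_sub_comm] at this
  · have := hq.sqrt_add_le f (u n - f)
    rwa [add_sub_cancel] at this

theorem midpoint_add (hq : IsQuadForm q) (f g : E) :
    q ((1 / 2 : ℝ) • (f + g)) + q ((1 / 2 : ℝ) • (f - g)) = (q f + q g) / 2 := by
  rw [hq.smul, hq.smul, ← mul_add, hq.parallelogram, ← mul_add, ← mul_assoc,
    ENNReal.div_eq_inv_mul]
  congr 1
  rw [show (2 : ℝ≥0∞) = ENNReal.ofReal 2 by simp, ← ENNReal.ofReal_mul (by norm_num),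
    ← ENNReal.ofReal_inv_of_pos (by norm_num)]
  norm_num

/-- Almost minimizers of a form over a decreasing sequence of midpoint-closed sets form a Cauchy
sequence for the form. -/
theorem exists_cauchy_of_midpoint (hq : IsQuadForm q) {K : ℕ → Set E} (hK : Antitone K)
    (hmid : ∀ k, ∀ f ∈ K k, ∀ g ∈ K k, (1 / 2 : ℝ) • (f + g) ∈ K k) {C : ℝ≥0∞} (hC : C ≠ ∞)
    (hKC : ∀ k, ∀ ε : ℝ≥0∞, 0 < ε → ∃ g ∈ K k, q g ≤ C + ε) :
    ∃ g : ℕ → E, (∀ k, g k ∈ K k) ∧ (∀ k, q (g k) ≤ C + ((k : ℝ≥0∞) + 1)⁻¹) ∧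
      ∀ ε : ℝ≥0∞, 0 < ε → ∃ M : ℕ, ∀ m ≥ M, ∀ n ≥ M, q (g m - g n) < ε := by
  -- The infima over the shrinking sets increase to a limit at most `C`. Two almost minimizers have
  -- a midpoint with value at least `c M`, so the parallelogram identity makes their difference
  -- small.
  set c : ℕ → ℝ≥0∞ := fun k => ⨅ g ∈ K k, q g with hc
  have hcC : ∀ k, c k ≤ C := fun k => by
    refine ENNReal.le_of_forall_pos_le_add fun ε hε _ => ?_
    obtain ⟨g, hg, hgC⟩ := hKC k ε (by exact_mod_cast hε)
    exact (iInf₂_le g hg).trans hgC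
  have hcm : Monotone c := fun a b hab => biInf_mono fun g hg => hK hab hg
  have hch : ∀ k, c k < c k + ((k : ℝ≥0∞) + 1)⁻¹ := fun k =>
    ENNReal.lt_add_right (ne_top_of_le_ne_top hC (hcC k)) (by simp)
  have hex : ∀ k, ∃ g ∈ K k, q g < c k + ((k : ℝ≥0∞) + 1)⁻¹ := fun k => by
    have := hch k
    rw [show c k = ⨅ g ∈ K k, q g from rfl, iInf_lt_iff] at this
    obtain ⟨g, h⟩ := this
    obtain ⟨hg, h⟩ := iInf_lt_iff.1 h
    exact ⟨g, hg, h⟩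
  choose g hgK hg using hex
  refine ⟨g, hgK, fun k => (hg k).le.trans (by gcongr; exact hcC k), fun ε hε => ?_⟩
  have hlim : Tendsto c atTop (𝓝 (⨆ k, c k)) := tendsto_atTop_iSup hcm
  have hs : (⨆ k, c k) ≠ ∞ := ne_top_of_le_ne_top hC (iSup_le hcC)
  set s := ⨆ k, c k
  have hinv : Tendsto (fun k : ℕ => ((k : ℝ≥0∞) + 1)⁻¹) atTop (𝓝 0) := by
    have := (tendsto_add_atTop_iff_nat 1).2 ENNReal.tendsto_inv_nat_nhds_zero
    simpa using this
  have hlim2 : Tendsto (fun M : ℕ => 4 * ((s - c M) + ((M : ℝ≥0∞) + 1)⁻¹)) atTop (𝓝 0) := by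
    have h1 : Tendsto (fun M : ℕ => s - c M) atTop (𝓝 0) := by
      simpa using ENNReal.Tendsto.sub (tendsto_const_nhds (x := s)) hlim (Or.inl hs)
    have h2 := ENNReal.Tendsto.const_mul (a := 4) (h1.add hinv) (Or.inr (by norm_num))
    simpa using h2
  obtain ⟨M, hM⟩ := (hlim2.eventually_lt_const hε).exists
  refine ⟨M, fun m hm n hn => lt_of_le_of_lt ?_ hM⟩
  have hbd : ∀ j ≥ M, q (g j) ≤ s + ((M : ℝ≥0∞) + 1)⁻¹ := fun j hj => by
    refine (hg j).le.trans ?_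
    gcongr
    exact le_iSup c j
  have hmidle : c M ≤ q ((1 / 2 : ℝ) • (g m + g n)) :=
    iInf₂_le _ (hmid M _ (hK hm (hgK m)) _ (hK hn (hgK n)))
  have hpar := hq.midpoint_add (g m) (g n)
  have h4 : q (g m - g n) = 4 * q ((1 / 2 : ℝ) • (g m - g n)) := by
    rw [hq.smul, ← mul_assoc, show (4 : ℝ≥0∞) = ENNReal.ofReal 4 by simp,
      ← ENNReal.ofReal_mul (by norm_num)]
    norm_num
  rw [h4]
  gcongr
  have hcM : c M ≠ ∞ := ne_top_of_le_ne_top hC (hcC M)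
  refine (ENNReal.add_le_add_iff_left hcM).1 ?_
  calc c M + q ((1 / 2 : ℝ) • (g m - g n))
      ≤ (q (g m) + q (g n)) / 2 := hpar ▸ add_le_add_left hmidle _
    _ ≤ ((s + ((M : ℝ≥0∞) + 1)⁻¹) + (s + ((M : ℝ≥0∞) + 1)⁻¹)) / 2 := by
        gcongr
        · exact hbd m hm
        · exact hbd n hn
    _ = s + ((M : ℝ≥0∞) + 1)⁻¹ := by
        rw [ENNReal.add_div, ENNReal.add_halves]
    _ = c M + ((s - c M) + ((M : ℝ≥0∞) + 1)⁻¹) := by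
        rw [← add_assoc, add_tsub_cancel_of_le (le_iSup c M)]

end IsQuadForm

end QuadForm

section LatticeForm

variable {E : Type*} [AddCommGroup E] [Module ℝ E] [Lattice E] [AddLeftMono E] {q : E → ℝ≥0∞}

theorem half_smul_add_sub_abs_sub (f g : E) :
    (1 / 2 : ℝ) • ((f + g) - |f - g|) = f ⊓ g := by
  have h := two_nsmul_inf_eq_add_sub_abs_sub g f
  rw [inf_comm, add_comm, ← h, ← Nat.cast_smul_eq_nsmul ℝ, smul_smul]
  norm_num

theorem half_smul_add_add_abs_sub (f g : E) :
    (1 / 2 : ℝ) • ((f + g) + |f - g|) = f ⊔ g := by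
  have h := two_nsmul_sup_eq_add_add_abs_sub g f
  rw [sup_comm, add_comm f, ← h, ← Nat.cast_smul_eq_nsmul ℝ, smul_smul]
  norm_num

/-- `f ⊓ g` and `f ⊔ g` are half the difference and half the sum of `f + g` and `|f - g|`. After the
parallelogram identity, the criterion replaces `|f - g|` by `f - g`. Lower semicontinuity uses the
criterion only through this inequality. -/
theorem IsQuadForm.inf_add_sup_le (hq : IsQuadForm q) (hBD : FirstBeurlingDeny q) (f g : E) :
    q (f ⊓ g) + q (f ⊔ g) ≤ q f + q g := by
  have h1 := hq.midpoint_add (f + g) |f - g|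
  rw [half_smul_add_sub_abs_sub, half_smul_add_add_abs_sub] at h1
  rw [add_comm, h1]
  calc (q (f + g) + q |f - g|) / 2 ≤ (q (f + g) + q (f - g)) / 2 := by
        gcongr
        exact hBD _
    _ = q f + q g := by
        rw [hq.parallelogram, ← mul_add, mul_comm, ENNReal.mul_div_cancel_right] <;> norm_num

theorem IsQuadForm.posPart_le (hq : IsQuadForm q) (hBD : FirstBeurlingDeny q) (f : E) :
    q f⁺ ≤ q f := by
  have h := hq.inf_add_sup_le hBD f 0
  rw [hq.map_zero, add_zero] at h
  exact le_add_self.trans h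

theorem IsQuadForm.negPart_le (hq : IsQuadForm q) (hBD : FirstBeurlingDeny q) (f : E) :
    q f⁻ ≤ q f := by
  have h := hq.posPart_le hBD (-f)
  rwa [posPart_neg, hq.map_neg] at h

end LatticeForm

/-! ### Local convergence in measure -/

section L0

variable {X : Type*} [MeasurableSpace X] {μ : Measure X}

instance MeasureTheory.AEEqFun.instAddLeftMonoReal : AddLeftMono (X →ₘ[μ] ℝ) := by
  refine ⟨fun f g₁ g₂ h => ?_⟩
  rw [← AEEqFun.coeFn_le] at h ⊢
  filter_upwards [AEEqFun.coeFn_add f g₁, AEEqFun.coeFn_add f g₂, h] with x h1 h2 h3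
  rw [h1, h2, Pi.add_apply, Pi.add_apply]
  exact add_le_add le_rfl h3

/-- Almost everywhere convergence of classes of functions. -/
def AETendsto (u : ℕ → X →ₘ[μ] ℝ) (f : X →ₘ[μ] ℝ) : Prop :=
  ∀ᵐ x ∂μ, Tendsto (fun n => u n x) atTop (𝓝 (f x))

theorem aetendsto_const (f : X →ₘ[μ] ℝ) : AETendsto (fun _ => f) f :=
  Eventually.of_forall fun _ => tendsto_const_nhds

theorem AETendsto.subseq {u : ℕ → X →ₘ[μ] ℝ} {f : X →ₘ[μ] ℝ} (h : AETendsto u f) {ns : ℕ → ℕ}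
    (hns : Tendsto ns atTop atTop) : AETendsto (fun k => u (ns k)) f := by
  filter_upwards [h] with x hx
  exact hx.comp hns

theorem AETendsto.sub {u v : ℕ → X →ₘ[μ] ℝ} {f g : X →ₘ[μ] ℝ} (hu : AETendsto u f)
    (hv : AETendsto v g) : AETendsto (fun n => u n - v n) (f - g) := by
  filter_upwards [hu, hv, ae_all_iff.2 fun n => AEEqFun.coeFn_sub (u n) (v n),
    AEEqFun.coeFn_sub f g] with x h1 h2 h3 h4
  simp only [h3, h4]
  exact h1.sub h2

theorem AETendsto.add {u v : ℕ → X →ₘ[μ] ℝ} {f g : X →ₘ[μ] ℝ} (hu : AETendsto u f)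
    (hv : AETendsto v g) : AETendsto (fun n => u n + v n) (f + g) := by
  filter_upwards [hu, hv, ae_all_iff.2 fun n => AEEqFun.coeFn_add (u n) (v n),
    AEEqFun.coeFn_add f g] with x h1 h2 h3 h4
  simp only [h3, h4]
  exact h1.add h2

theorem AETendsto.inf {u v : ℕ → X →ₘ[μ] ℝ} {f g : X →ₘ[μ] ℝ} (hu : AETendsto u f)
    (hv : AETendsto v g) : AETendsto (fun n => u n ⊓ v n) (f ⊓ g) := by
  filter_upwards [hu, hv, ae_all_iff.2 fun n => AEEqFun.coeFn_inf (u n) (v n),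
    AEEqFun.coeFn_inf f g] with x h1 h2 h3 h4
  simp only [h3, h4]
  exact h1.inf_nhds h2

theorem AETendsto.sup {u v : ℕ → X →ₘ[μ] ℝ} {f g : X →ₘ[μ] ℝ} (hu : AETendsto u f)
    (hv : AETendsto v g) : AETendsto (fun n => u n ⊔ v n) (f ⊔ g) := by
  filter_upwards [hu, hv, ae_all_iff.2 fun n => AEEqFun.coeFn_sup (u n) (v n),
    AEEqFun.coeFn_sup f g] with x h1 h2 h3 h4
  simp only [h3, h4]
  exact h1.sup_nhds h2

theorem AETendsto.neg {u : ℕ → X →ₘ[μ] ℝ} {f : X →ₘ[μ] ℝ} (hu : AETendsto u f) :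
    AETendsto (fun n => -u n) (-f) := by
  simpa using (aetendsto_const 0).sub hu

theorem AETendsto.posPart {u : ℕ → X →ₘ[μ] ℝ} {f : X →ₘ[μ] ℝ} (hu : AETendsto u f) :
    AETendsto (fun n => (u n)⁺) f⁺ :=
  hu.sup (aetendsto_const 0)

theorem AETendsto.negPart {u : ℕ → X →ₘ[μ] ℝ} {f : X →ₘ[μ] ℝ} (hu : AETendsto u f) :
    AETendsto (fun n => (u n)⁻) f⁻ :=
  hu.neg.sup (aetendsto_const 0)

variable {φ : X → ℝ}

theorem aemeasurable_normL0_integrand (hφ : Integrable φ μ) (f : X →ₘ[μ] ℝ) :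
    AEMeasurable (fun x => ENNReal.ofReal (min |f x| 1 * φ x)) μ := by
  have h1 := f.aestronglyMeasurable.aemeasurable
  have h2 := hφ.aestronglyMeasurable.aemeasurable
  fun_prop

theorem normL0_mono (hφpos : ∀ x, 0 < φ x) {f g : X →ₘ[μ] ℝ} (h : ∀ᵐ x ∂μ, |f x| ≤ |g x|) :
    normL0 φ f ≤ normL0 φ g := by
  refine lintegral_mono_ae ?_
  filter_upwards [h] with x hx
  have := (hφpos x).le
  gcongr

theorem normL0_smul_le (hφ : Integrable φ μ) (hφpos : ∀ x, 0 < φ x) (c : ℝ) (f : X →ₘ[μ] ℝ) :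
    normL0 φ (c • f) ≤ ENNReal.ofReal (max |c| 1) * normL0 φ f := by
  unfold normL0
  rw [← lintegral_const_mul'' _ (aemeasurable_normL0_integrand hφ f)]
  refine lintegral_mono_ae ?_
  filter_upwards [AEEqFun.coeFn_smul c f] with x hx
  rw [← ENNReal.ofReal_mul (by positivity), ← mul_assoc]
  have := (hφpos x).le
  gcongr
  rw [hx, Pi.smul_apply, smul_eq_mul, abs_mul, mul_min_of_nonneg _ _ (by positivity)]
  refine min_le_min ?_ ?_
  · gcongr
    exact le_max_left _ _
  · simp

theorem isFNorm_normL0 (hφ : Integrable φ μ) (hφpos : ∀ x, 0 < φ x) :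
    IsFNorm (normL0 φ : (X →ₘ[μ] ℝ) → ℝ≥0∞) where
  map_zero := by
    refine (lintegral_eq_zero_iff' (aemeasurable_normL0_integrand hφ 0)).2 ?_
    filter_upwards [AEEqFun.coeFn_zero (α := X) (μ := μ) (β := ℝ)] with x hx
    simp [hx]
  add_le f g := by
    unfold normL0
    rw [← lintegral_add_left' (aemeasurable_normL0_integrand hφ f)]
    refine lintegral_mono_ae ?_
    filter_upwards [AEEqFun.coeFn_add f g] with x hx
    have h0 := hφpos x
    rw [← ENNReal.ofReal_add (by positivity) (by positivity), ← add_mul, hx, Pi.add_apply]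
    gcongr
    have h1 := abs_add_le (f x) (g x)
    have h2 := abs_nonneg (f x)
    have h3 := abs_nonneg (g x)
    rcases min_cases |f x| 1 with ⟨h, -⟩ | ⟨h, -⟩ <;> rcases min_cases |g x| 1 with ⟨h', -⟩ | ⟨h', -⟩
      <;> rw [h, h']
    · exact (min_le_left _ _).trans h1
    all_goals exact (min_le_right _ _).trans (by linarith)
  map_neg f := by
    refine lintegral_congr_ae ?_
    filter_upwards [AEEqFun.coeFn_neg f] with x hx
    rw [hx, Pi.neg_apply, abs_neg]
  eq_zero f h := by
    rw [normL0, lintegral_eq_zero_iff' (aemeasurable_normL0_integrand hφ f)] at h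
    refine AEEqFun.ext ?_
    filter_upwards [h, AEEqFun.coeFn_zero (α := X) (μ := μ) (β := ℝ)] with x hx h0
    rw [h0, Pi.zero_apply]
    have h1 := ENNReal.ofReal_eq_zero.1 hx
    have h2 := nonpos_of_mul_nonpos_left h1 (hφpos x)
    rcases min_le_iff.1 h2 with h3 | h3
    · exact abs_eq_zero.1 (le_antisymm h3 (abs_nonneg _))
    · norm_num at h3

theorem AETendsto.tendsto_normL0 (hφ : Integrable φ μ) (hφpos : ∀ x, 0 < φ x)
    {u : ℕ → X →ₘ[μ] ℝ} {f : X →ₘ[μ] ℝ} (h : AETendsto u f) :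
    Tendsto (fun n => normL0 φ (u n - f)) atTop (𝓝 0) := by
  have key := tendsto_lintegral_of_dominated_convergence' (μ := μ)
    (F := fun n x => ENNReal.ofReal (min |(u n - f : X →ₘ[μ] ℝ) x| 1 * φ x)) (f := fun _ => 0)
    (fun x => ENNReal.ofReal (φ x)) (fun n => aemeasurable_normL0_integrand hφ _)
    (fun n => Eventually.of_forall fun x => ?_) hφ.lintegral_lt_top.ne ?_
  · rwa [lintegral_zero] at key
  · have := hφpos x
    refine ENNReal.ofReal_le_ofReal ?_
    exact mul_le_of_le_one_left this.le (min_le_right _ _)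
  · filter_upwards [h, ae_all_iff.2 fun n => AEEqFun.coeFn_sub (u n) f] with x h1 h2
    have h3 : Tendsto (fun n => min |u n x - f x| 1 * φ x) atTop
        (𝓝 (min |f x - f x| 1 * φ x)) :=
      (((h1.sub_const _).abs).min tendsto_const_nhds).mul_const _
    have h4 := ENNReal.tendsto_ofReal h3
    simpa [h2] using h4

/-- Exchanging sum and integral makes the truncated series finite almost everywhere. Its terms tend
to zero, so the truncation at `1` is eventually inactive. -/
theorem ae_summable_of_tsum_normL0 (hφ : Integrable φ μ) (hφpos : ∀ x, 0 < φ x)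
    {d : ℕ → X →ₘ[μ] ℝ} (h : ∑' k, normL0 φ (d k) ≠ ∞) :
    ∀ᵐ x ∂μ, Summable fun k => |d k x| := by
  unfold normL0 at h
  rw [← lintegral_tsum fun k => aemeasurable_normL0_integrand hφ (d k)] at h
  filter_upwards [ae_lt_top' (AEMeasurable.tsum fun k =>
    aemeasurable_normL0_integrand hφ (d k)) h] with x hx
  have h0 := hφpos x
  have h1 := ENNReal.summable_toReal hx.ne
  have h2 : Summable fun k => min |d k x| 1 := by
    have h3 := h1.mul_right (φ x)⁻¹
    refine h3.congr fun k => ?_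
    rw [ENNReal.toReal_ofReal (by positivity), mul_inv_cancel_right₀ h0.ne']
  refine h2.congr_atTop ?_
  filter_upwards [h2.tendsto_atTop_zero.eventually_lt_const one_pos] with k hk
  rcases min_lt_iff.1 hk with h4 | h4
  · exact min_eq_left h4.le
  · exact absurd h4 (lt_irrefl _)

theorem exists_subseq_aetendsto (hφ : Integrable φ μ) (hφpos : ∀ x, 0 < φ x)
    {u : ℕ → X →ₘ[μ] ℝ} {f : X →ₘ[μ] ℝ}
    (h : Tendsto (fun n => normL0 φ (u n - f)) atTop (𝓝 0)) :
    ∃ ns : ℕ → ℕ, StrictMono ns ∧ AETendsto (fun k => u (ns k)) f := by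
  obtain ⟨ns, hns, hlt⟩ := extraction_forall_of_eventually
    (P := fun k n => normL0 φ (u n - f) < (2 : ℝ≥0∞)⁻¹ ^ k) fun k =>
      h.eventually_lt_const (ENNReal.pow_pos (by simp) k)
  refine ⟨ns, hns, ?_⟩
  have hsum : ∑' k, normL0 φ (u (ns k) - f) ≠ ∞ := by
    refine ne_top_of_le_ne_top ?_ (ENNReal.tsum_le_tsum fun k => (hlt k).le)
    rw [ENNReal.tsum_geometric]
    simp
  filter_upwards [ae_summable_of_tsum_normL0 hφ hφpos hsum,
    ae_all_iff.2 fun k => AEEqFun.coeFn_sub (u (ns k)) f] with x h1 h2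
  have h3 := (tendsto_zero_iff_abs_tendsto_zero _).2 h1.tendsto_atTop_zero
  simp only [h2, Pi.sub_apply] at h3
  exact tendsto_sub_nhds_zero_iff.1 h3

/-- The space of classes of measurable functions is complete for local convergence in measure. -/
theorem exists_tendsto_normL0_of_cauchy (hφ : Integrable φ μ) (hφpos : ∀ x, 0 < φ x)
    {u : ℕ → X →ₘ[μ] ℝ}
    (h : ∀ ε : ℝ≥0∞, 0 < ε → ∃ K : ℕ, ∀ m ≥ K, ∀ n ≥ K, normL0 φ (u m - u n) < ε) :
    ∃ f : X →ₘ[μ] ℝ, Tendsto (fun n => normL0 φ (u n - f)) atTop (𝓝 0) := by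
  have hN := isFNorm_normL0 (μ := μ) hφ hφpos
  obtain ⟨ns, hns, hlt⟩ := extraction_forall_of_eventually
    (P := fun k n => ∀ m ≥ n, normL0 φ (u m - u n) < (2 : ℝ≥0∞)⁻¹ ^ k) fun k => by
      obtain ⟨K, hK⟩ := h ((2 : ℝ≥0∞)⁻¹ ^ k) (ENNReal.pow_pos (by simp) k)
      exact eventually_atTop.2 ⟨K, fun n hn m hm => hK m (hn.trans hm) n hn⟩
  have hsum : ∑' k, normL0 φ (u (ns (k + 1)) - u (ns k)) ≠ ∞ := by
    refine ne_top_of_le_ne_top ?_ (ENNReal.tsum_le_tsum fun k =>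
      (hlt k _ (hns k.lt_succ_self).le).le)
    rw [ENNReal.tsum_geometric]
    simp
  obtain ⟨g, hg, hlim⟩ := exists_stronglyMeasurable_limit_of_tendsto_ae (μ := μ)
    (f := fun k => (u (ns k) : X → ℝ)) (fun k => (u (ns k)).aestronglyMeasurable) (by
      filter_upwards [ae_summable_of_tsum_normL0 hφ hφpos hsum,
        ae_all_iff.2 fun k => AEEqFun.coeFn_sub (u (ns (k + 1))) (u (ns k))] with x h1 h2
      refine cauchySeq_tendsto_of_complete (cauchySeq_of_summable_dist ?_)
      refine h1.congr fun k => ?_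
      rw [h2, Pi.sub_apply, dist_comm, Real.dist_eq])
  set f : X →ₘ[μ] ℝ := AEEqFun.mk g hg.aestronglyMeasurable
  have hae : AETendsto (fun k => u (ns k)) f := by
    filter_upwards [hlim, AEEqFun.coeFn_mk g hg.aestronglyMeasurable] with x h1 h2
    rwa [h2]
  have hsub := hae.tendsto_normL0 hφ hφpos
  refine ⟨f, ENNReal.tendsto_nhds_zero.2 fun ε hε => ?_⟩
  have hε2 : 0 < ε / 2 := ENNReal.half_pos hε.ne'
  obtain ⟨K, hK⟩ := h _ hε2
  obtain ⟨k, hk, hkK⟩ := ((hsub.eventually_lt_const hε2).and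
    (hns.tendsto_atTop.eventually_ge_atTop K)).exists
  filter_upwards [eventually_ge_atTop K] with n hn
  calc normL0 φ (u n - f) ≤ normL0 φ (u n - u (ns k)) + normL0 φ (u (ns k) - f) :=
        hN.sub_le _ _ _
    _ ≤ ε / 2 + ε / 2 := add_le_add (hK n hn _ hkK).le hk.le
    _ = ε := ENNReal.add_halves _

end L0

/-! ### Forms on `L²` -/

section L2

variable {X : Type*} [MeasurableSpace X] {μ : Measure X} {q : Lp ℝ 2 μ → ℝ≥0∞}

theorem isFNorm_normL2 : IsFNorm (normL2 : Lp ℝ 2 μ → ℝ≥0∞) where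
  map_zero := enorm_zero
  add_le f g := enorm_add_le f g
  map_neg f := enorm_neg f
  eq_zero f h := by simpa [normL2] using h

theorem formOnL0_coe (q : Lp ℝ 2 μ → ℝ≥0∞) (f : Lp ℝ 2 μ) :
    formOnL0 q (f : X →ₘ[μ] ℝ) = q f := by
  simp [formOnL0]

theorem mem_Lp_of_formOnL0_ne_top {f : X →ₘ[μ] ℝ} (h : formOnL0 q f ≠ ∞) : f ∈ Lp ℝ 2 μ := by
  by_contra hf
  simp [formOnL0, hf] at h

theorem formOnL0_of_notMem {f : X →ₘ[μ] ℝ} (h : f ∉ Lp ℝ 2 μ) : formOnL0 q f = ∞ := by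
  simp [formOnL0, h]

theorem isQuadForm_formOnL0 (hq : IsQuadForm q) : IsQuadForm (formOnL0 q) where
  smul c f := by
    by_cases hf : f ∈ Lp ℝ 2 μ
    · lift f to Lp ℝ 2 μ using hf
      rw [show c • (f : X →ₘ[μ] ℝ) = ((c • f : Lp ℝ 2 μ) : X →ₘ[μ] ℝ) from rfl, formOnL0_coe,
        formOnL0_coe, hq.smul]
    rcases eq_or_ne c 0 with rfl | hc
    · have := formOnL0_coe q 0
      rw [AddSubgroup.coe_zero] at this
      simp [this, hq.map_zero]
    have hcf : c • f ∉ Lp ℝ 2 μ := fun h => hf (by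
      have := Lp.const_smul_mem_Lp c⁻¹ ⟨c • f, h⟩
      rwa [smul_smul, inv_mul_cancel₀ hc, one_smul] at this)
    rw [formOnL0_of_notMem hf, formOnL0_of_notMem hcf, ENNReal.mul_top]
    simpa using hc
  parallelogram f g := by
    by_cases hfg : f ∈ Lp ℝ 2 μ ∧ g ∈ Lp ℝ 2 μ
    · obtain ⟨hf, hg⟩ := hfg
      lift f to Lp ℝ 2 μ using hf
      lift g to Lp ℝ 2 μ using hg
      rw [← AddSubgroup.coe_add, ← AddSubgroup.coe_sub]
      simp only [formOnL0_coe]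
      exact hq.parallelogram f g
    have h1 : 2 * formOnL0 q f + 2 * formOnL0 q g = ∞ := by
      rcases not_and_or.1 hfg with h | h <;> simp [formOnL0_of_notMem h]
    rw [h1]
    -- A finite left side puts `f + g` and `f - g` in `L²`, hence also `f` and `g`.
    by_contra h2
    obtain ⟨h3, h4⟩ := ENNReal.add_ne_top.1 h2
    have h3 := mem_Lp_of_formOnL0_ne_top h3
    have h4 := mem_Lp_of_formOnL0_ne_top h4
    have hf : f = (1 / 2 : ℝ) • ((f + g) + (f - g)) := by
      rw [add_add_sub_cancel, ← two_smul ℝ f, smul_smul]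
      norm_num
    have hg : g = (1 / 2 : ℝ) • ((f + g) - (f - g)) := by
      rw [add_sub_sub_cancel, ← two_smul ℝ g, smul_smul]
      norm_num
    refine hfg ⟨?_, ?_⟩
    · rw [hf]
      exact Lp.const_smul_mem_Lp _ ⟨_, add_mem h3 h4⟩
    · rw [hg]
      exact Lp.const_smul_mem_Lp _ ⟨_, sub_mem h3 h4⟩

theorem firstBeurlingDeny_formOnL0 (hBD : FirstBeurlingDeny q) :
    FirstBeurlingDeny (formOnL0 q) := fun f => by
  by_cases hf : f ∈ Lp ℝ 2 μ
  · lift f to Lp ℝ 2 μ using hf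
    rw [formOnL0_coe, show |(f : X →ₘ[μ] ℝ)| = ((|f| : Lp ℝ 2 μ) : X →ₘ[μ] ℝ) from rfl,
      formOnL0_coe]
    exact hBD f
  · rw [formOnL0_of_notMem hf]
    exact le_top

/-- Closed forms are lower semicontinuous. -/
theorem le_of_tendsto_Lp (hq : IsQuadForm q) (hclosed : IsClosedForm normL2 q)
    {u : ℕ → Lp ℝ 2 μ} {f : Lp ℝ 2 μ} (hu : Tendsto u atTop (𝓝 f)) {C : ℝ≥0∞} (hC : C ≠ ∞)
    (huC : ∀ n, q (u n) ≤ C) : q f ≤ C := by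
  -- Almost minimizers over balls shrinking to `f` converge to `f` and are Cauchy for the form;
  -- closedness then gives convergence in the form metric.
  obtain ⟨g, hgK, hgC, hcau⟩ := hq.exists_cauchy_of_midpoint
    (K := fun k : ℕ => Metric.closedBall f (1 / ((k : ℝ) + 1)))
    (fun a b hab => Metric.closedBall_subset_closedBall (Nat.one_div_le_one_div hab))
    (fun k a ha b hb => by
      have := (convex_closedBall f (1 / ((k : ℝ) + 1))) ha hb
        (show (0 : ℝ) ≤ 1 / 2 by norm_num) (show (0 : ℝ) ≤ 1 / 2 by norm_num) (by norm_num)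
      rwa [← smul_add] at this)
    hC fun k ε _ => by
      obtain ⟨n, hn⟩ := (hu.eventually (Metric.closedBall_mem_nhds f
        (Nat.one_div_pos_of_nat (n := k)))).exists
      exact ⟨u n, hn, (huC n).trans le_self_add⟩
  have hgf : Tendsto g atTop (𝓝 f) :=
    tendsto_iff_dist_tendsto_zero.2 (squeeze_zero (fun _ => dist_nonneg) hgK
      tendsto_one_div_add_atTop_nhds_zero_nat)
  have hN : Tendsto (fun n => normL2 (g n - f)) atTop (𝓝 0) := by
    have := tendsto_iff_edist_tendsto_0.1 hgf
    simpa [edist_eq_enorm_sub, normL2] using this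
  have hfin : ∀ n, q (g n) ≠ ∞ := fun n => ne_top_of_le_ne_top (by finiteness) (hgC n)
  obtain ⟨-, hlim⟩ := hclosed.tendsto_of_cauchy isFNorm_normL2 hfin hcau hN
  have h1 := hq.tendsto_sqrt hlim
  have h2 : Tendsto (fun k : ℕ => (C + ((k : ℝ≥0∞) + 1)⁻¹) ^ (1 / 2 : ℝ)) atTop
      (𝓝 (C ^ (1 / 2 : ℝ))) := by
    have h3 : Tendsto (fun k : ℕ => C + ((k : ℝ≥0∞) + 1)⁻¹) atTop (𝓝 C) := by
      have := (tendsto_add_atTop_iff_nat 1).2 ENNReal.tendsto_inv_nat_nhds_zero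
      simpa using this.const_add C
    exact (ENNReal.continuous_rpow_const.tendsto C).comp h3
  have h4 := le_of_tendsto_of_tendsto' h1 h2 fun k =>
    ENNReal.rpow_le_rpow (hgC k) (by norm_num)
  exact (ENNReal.rpow_le_rpow_iff (by norm_num)).1 h4

theorem mem_Lp_of_abs_le {f G : X →ₘ[μ] ℝ} (hG : G ∈ Lp ℝ 2 μ) (h : ∀ᵐ x ∂μ, |f x| ≤ G x) :
    f ∈ Lp ℝ 2 μ :=
  Lp.mem_Lp_iff_memLp.2 ((Lp.mem_Lp_iff_memLp.1 hG).mono' f.aestronglyMeasurable h)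

/-- Closed forms are lower semicontinuous for dominated convergence. -/
theorem le_of_dominated (hq : IsQuadForm q) (hclosed : IsClosedForm normL2 q)
    {u : ℕ → X →ₘ[μ] ℝ} {f G : X →ₘ[μ] ℝ} (hG : G ∈ Lp ℝ 2 μ)
    (hdom : ∀ n, ∀ᵐ x ∂μ, |u n x| ≤ G x) (hu : AETendsto u f) {C : ℝ≥0∞} (hC : C ≠ ∞)
    (huC : ∀ n, formOnL0 q (u n) ≤ C) : formOnL0 q f ≤ C := by
  have hu2 : ∀ n, u n ∈ Lp ℝ 2 μ := fun n => mem_Lp_of_abs_le hG (hdom n)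
  have hfG : ∀ᵐ x ∂μ, |f x| ≤ G x := by
    filter_upwards [hu, ae_all_iff.2 hdom] with x h1 h2
    exact le_of_tendsto' h1.abs h2
  lift f to Lp ℝ 2 μ using mem_Lp_of_abs_le hG hfG
  lift u to ℕ → Lp ℝ 2 μ using hu2
  simp only [formOnL0_coe] at huC ⊢
  refine le_of_tendsto_Lp hq hclosed ?_ hC huC
  rw [Lp.tendsto_Lp_iff_tendsto_eLpNorm']
  have hG2 := (Lp.mem_Lp_iff_memLp.1 hG)
  have hGint : ∫⁻ x, ‖2 * G x‖ₑ ^ (2 : ℝ) ∂μ ≠ ∞ := by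
    have := lintegral_rpow_enorm_lt_top_of_eLpNorm_lt_top (p := 2) (by norm_num) (by norm_num)
      (hG2.const_mul 2).2
    simpa using this.ne
  have key := tendsto_lintegral_of_dominated_convergence' (μ := μ)
    (F := fun n x => ‖((u n : X → ℝ) - f) x‖ₑ ^ (2 : ℝ)) (f := fun _ => 0)
    (fun x => ‖2 * G x‖ₑ ^ (2 : ℝ)) (fun n => ?_) (fun n => ?_) hGint ?_
  · rw [lintegral_zero] at key
    have := (ENNReal.continuous_rpow_const (y := 1 / 2)).tendsto 0 |>.comp key
    simpa [eLpNorm_eq_lintegral_rpow_enorm_toReal, Function.comp_def] using this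
  · exact (((Lp.aestronglyMeasurable (u n)).sub (Lp.aestronglyMeasurable f)).enorm).pow_const _
  · filter_upwards [hdom n, hfG] with x h1 h2
    refine ENNReal.rpow_le_rpow ?_ (by norm_num)
    rw [Pi.sub_apply, enorm_le_iff_norm_le, Real.norm_eq_abs, Real.norm_eq_abs]
    refine le_trans ?_ (le_abs_self _)
    have := abs_sub ((u n : X →ₘ[μ] ℝ) x) ((f : X →ₘ[μ] ℝ) x)
    linarith
  · filter_upwards [hu] with x h1
    have h2 : Tendsto (fun n => ‖(u n : X →ₘ[μ] ℝ) x - (f : X →ₘ[μ] ℝ) x‖ₑ) atTop (𝓝 0) := by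
      have := (h1.sub_const ((f : X →ₘ[μ] ℝ) x)).enorm
      simpa using this
    have := (ENNReal.continuous_rpow_const (y := 2)).tendsto 0 |>.comp h2
    simpa [Function.comp_def] using this

end L2

/-! ### Lower semicontinuity with respect to local convergence in measure -/

section Lsc

variable {X : Type*} [MeasurableSpace X] {μ : Measure X} {q : Lp ℝ 2 μ → ℝ≥0∞}

theorem abs_mem_Lp {f : X →ₘ[μ] ℝ} (hf : f ∈ Lp ℝ 2 μ) : |f| ∈ Lp ℝ 2 μ :=
  (|(⟨f, hf⟩ : Lp ℝ 2 μ)|).2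

theorem ae_nonneg {f : X →ₘ[μ] ℝ} (hf : 0 ≤ f) : ∀ᵐ x ∂μ, 0 ≤ f x := by
  filter_upwards [AEEqFun.coeFn_le.2 hf, AEEqFun.coeFn_zero (α := X) (μ := μ) (β := ℝ)]
    with x h1 h2
  simpa [h2] using h1

theorem ae_abs_inf_le {f g : X →ₘ[μ] ℝ} (hf : 0 ≤ f) (hg : 0 ≤ g) :
    ∀ᵐ x ∂μ, |(f ⊓ g : X →ₘ[μ] ℝ) x| ≤ g x := by
  filter_upwards [ae_nonneg hf, ae_nonneg hg, AEEqFun.coeFn_inf f g] with x h1 h2 h3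
  rw [h3, abs_of_nonneg (le_inf h1 h2)]
  exact inf_le_right

/-- Form-bounded sequences tending to zero dominatedly tend to zero weakly. -/
theorem tendsto_formPolar_of_dominated (hq : IsQuadForm q) (hclosed : IsClosedForm normL2 q)
    {z : ℕ → X →ₘ[μ] ℝ} {G : X →ₘ[μ] ℝ} (hG : G ∈ Lp ℝ 2 μ)
    (hdom : ∀ n, ∀ᵐ x ∂μ, |z n x| ≤ G x) (hz : AETendsto z 0) {C : ℝ≥0∞} (hC : C ≠ ∞)
    (hzC : ∀ n, formOnL0 q (z n) ≤ C) {f : X →ₘ[μ] ℝ} (hf : formOnL0 q f ≠ ∞) :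
    Tendsto (fun n => formPolar (formOnL0 q) f (z n)) atTop (𝓝 0) := by
  have hQ := isQuadForm_formOnL0 hq
  have hzf : ∀ n, formOnL0 q (z n) ≠ ∞ := fun n => ne_top_of_le_ne_top hC (hzC n)
  have key : ∀ f : X →ₘ[μ] ℝ, formOnL0 q f ≠ ∞ → ∀ ε : ℝ, 0 < ε →
      ∀ᶠ n in atTop, formPolar (formOnL0 q) f (z n) ≤ ε := by
    intro f hf ε hε
    by_contra hcon
    obtain ⟨ns, hns, hlt⟩ := extraction_of_frequently_atTop (not_eventually.1 hcon)
    -- Lower semicontinuity along `-m f + z (ns k) → -m f` would give `q (-m f) ≤ q (-m f) - 2 m ε +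
    -- C`, impossible once `2 m ε > C`.
    obtain ⟨m, hm⟩ := exists_nat_gt (C.toReal / (2 * ε))
    rw [div_lt_iff₀ (by positivity)] at hm
    have hmf := hQ.smul_ne_top (-(m : ℝ)) hf
    have hbound : ∀ k, (formOnL0 q ((-(m : ℝ)) • f + z (ns k))).toReal ≤
        (formOnL0 q ((-(m : ℝ)) • f)).toReal - 2 * m * ε + C.toReal := fun k => by
      have h1 := toReal_form_add (formOnL0 q) ((-(m : ℝ)) • f) (z (ns k))
      have h2 := hQ.formPolar_ratCast_smul_right (hzf (ns k)) hf (-m)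
      rw [formPolar_comm _ _ f, formPolar_comm, Rat.cast_neg, Rat.cast_natCast] at h2
      have h3 := (not_le.1 (hlt k)).le
      have h4 := ENNReal.toReal_mono hC (hzC (ns k))
      have h5 : (m : ℝ) * ε ≤ m * formPolar (formOnL0 q) f (z (ns k)) := by gcongr
      rw [h1, h2]
      linarith
    have hlim : AETendsto (fun k => (-(m : ℝ)) • f + z (ns k)) ((-(m : ℝ)) • f) := by
      simpa using (aetendsto_const ((-(m : ℝ)) • f)).add (hz.subseq hns.tendsto_atTop)
    have hle := le_of_dominated hq hclosed (G := |(-(m : ℝ)) • f| + G)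
      (add_mem (abs_mem_Lp (mem_Lp_of_formOnL0_ne_top hmf)) hG) (fun k => by
        filter_upwards [hdom (ns k),
          AEEqFun.coeFn_add ((-(m : ℝ)) • f) (z (ns k)),
          AEEqFun.coeFn_add |(-(m : ℝ)) • f| G,
          AEEqFun.coeFn_abs ((-(m : ℝ)) • f)] with x h1 h2 h3 h4
        rw [h2, h3, Pi.add_apply, Pi.add_apply, h4]
        exact (abs_add_le _ _).trans (by gcongr))
      hlim ENNReal.ofReal_ne_top fun k => by
        rw [← ENNReal.ofReal_toReal (hQ.add_ne_top hmf (hzf (ns k)))]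
        exact ENNReal.ofReal_le_ofReal (hbound k)
    have := ENNReal.toReal_le_of_le_ofReal (ENNReal.toReal_nonneg.trans (hbound 0)) hle
    linarith
  exact hQ.tendsto_formPolar_of_eventually_le hzf key hf

/-- Form-bounded nonnegative sequences tending to zero almost everywhere tend to zero weakly. -/
theorem tendsto_formPolar_of_nonneg (hq : IsQuadForm q) (hclosed : IsClosedForm normL2 q)
    (hBD : FirstBeurlingDeny q) {u : ℕ → X →ₘ[μ] ℝ} (hu0 : ∀ n, 0 ≤ u n) (hu : AETendsto u 0)
    {C : ℝ≥0∞} (hC : C ≠ ∞) (huC : ∀ n, formOnL0 q (u n) ≤ C) {f : X →ₘ[μ] ℝ}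
    (hf : formOnL0 q f ≠ ∞) :
    Tendsto (fun n => formPolar (formOnL0 q) f (u n)) atTop (𝓝 0) := by
  have hQ := isQuadForm_formOnL0 hq
  have hB := firstBeurlingDeny_formOnL0 hBD
  have huf : ∀ n, formOnL0 q (u n) ≠ ∞ := fun n => ne_top_of_le_ne_top hC (huC n)
  have key : ∀ f : X →ₘ[μ] ℝ, formOnL0 q f ≠ ∞ → ∀ δ : ℝ, 0 < δ →
      ∀ᶠ n in atTop, formPolar (formOnL0 q) f (u n) ≤ δ := by
    intro f hf δ hδ
    by_contra hcon
    have hfreq := not_eventually.1 hcon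
    -- Induction by joining one more term `u n` to `U`: the energy rises by at most `C`, the pairing
    -- with `f` by at least `δ / 2`.
    have hex : ∀ N : ℕ, ∃ U : X →ₘ[μ] ℝ, 0 ≤ U ∧ formOnL0 q U ≤ N * C ∧
        N * (δ / 2) ≤ formPolar (formOnL0 q) f U := by
      intro N
      induction N with
      | zero => exact ⟨0, le_rfl, by simp [hQ.map_zero], by simp [formPolar, hQ.map_zero]⟩
      | succ N ih =>
        obtain ⟨U, hU0, hUC, hUδ⟩ := ih
        have hUf : formOnL0 q U ≠ ∞ := ne_top_of_le_ne_top (by finiteness) hUC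
        have hsum : ∀ n, formOnL0 q (u n ⊓ U) + formOnL0 q (u n ⊔ U) ≤ (N + 1 : ℕ) * C :=
          fun n => (hQ.inf_add_sup_le hB _ _).trans <| by
            rw [Nat.cast_succ, add_mul, one_mul, add_comm]
            exact add_le_add hUC (huC n)
        have hlim : AETendsto (fun n => u n ⊓ U) 0 := by
          have := hu.inf (aetendsto_const U)
          rwa [inf_of_le_left hU0] at this
        have hzC : ∀ n, formOnL0 q (u n ⊓ U) ≤ (N + 1 : ℕ) * C := fun n =>
          le_self_add.trans (hsum n)
        have hCN : ((N + 1 : ℕ) : ℝ≥0∞) * C ≠ ∞ := by finiteness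
        have hz := tendsto_formPolar_of_dominated hq hclosed (mem_Lp_of_formOnL0_ne_top hUf)
          (fun n => ae_abs_inf_le (hu0 n) hU0) hlim hCN hzC hf
        obtain ⟨n, hn1, hn2⟩ :=
          (hfreq.and_eventually (hz.eventually_lt_const (half_pos hδ))).exists
        have hzf := ne_top_of_le_ne_top hCN (hzC n)
        have hsf := ne_top_of_le_ne_top hCN (le_add_self.trans (hsum n))
        refine ⟨u n ⊔ U, hU0.trans le_sup_right, le_add_self.trans (hsum n), ?_⟩
        -- Since `u n ⊓ U + u n ⊔ U = u n + U`, the new pairing is the old one plus more than `δ`,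
        -- minus the pairing with the meet, which is below `δ / 2` for this `n`.
        have h1 := congrArg (formPolar (formOnL0 q) f) (inf_add_sup (u n) U)
        rw [hQ.formPolar_add_right hf hzf hsf, hQ.formPolar_add_right hf (huf n) hUf] at h1
        push_cast
        linarith [not_le.1 hn1]
    -- Cauchy–Schwarz would force `(N * (δ / 2)) ^ 2 ≤ q f * (N * C)`, which this `N` violates.
    obtain ⟨N, hN⟩ := exists_nat_gt ((formOnL0 q f).toReal * C.toReal / (δ / 2) ^ 2)
    rw [div_lt_iff₀ (by positivity)] at hN
    obtain ⟨U, -, hUC, hUδ⟩ := hex N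
    have hUf : formOnL0 q U ≠ ∞ := ne_top_of_le_ne_top (by finiteness) hUC
    have h1 := hQ.formPolar_sq_le hf hUf
    have h2 : (formOnL0 q U).toReal ≤ N * C.toReal := by
      have := ENNReal.toReal_mono (by finiteness) hUC
      simpa using this
    have h3 : (N * (δ / 2)) ^ 2 ≤ formPolar (formOnL0 q) f U ^ 2 := by gcongr
    have h4 : (formOnL0 q f).toReal * (formOnL0 q U).toReal ≤
        (formOnL0 q f).toReal * (N * C.toReal) := by gcongr
    have h5 : (0 : ℝ) < N := by
      have : 0 ≤ (formOnL0 q f).toReal * C.toReal := by positivity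
      by_contra h6
      nlinarith [sq_nonneg (δ / 2)]
    nlinarith
  exact hQ.tendsto_formPolar_of_eventually_le huf key hf

/-- Two dominated limits: `u n ⊓ u m → f ⊓ u m` in `n`, dominated by `u m`, and then `u m ⊓ f → f`
in `m`, dominated by `f`. The resulting bound `C + C` is not sharp, but finiteness is what the
polarization with `f` needs. -/
theorem formOnL0_ne_top_of_nonneg (hq : IsQuadForm q) (hclosed : IsClosedForm normL2 q)
    (hBD : FirstBeurlingDeny q) {u : ℕ → X →ₘ[μ] ℝ} {f : X →ₘ[μ] ℝ} (hf : f ∈ Lp ℝ 2 μ)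
    (hu0 : ∀ n, 0 ≤ u n) (hf0 : 0 ≤ f) (hu : AETendsto u f) {C : ℝ≥0∞} (hC : C ≠ ∞)
    (huC : ∀ n, formOnL0 q (u n) ≤ C) : formOnL0 q f ≠ ∞ := by
  have hQ := isQuadForm_formOnL0 hq
  have hB := firstBeurlingDeny_formOnL0 hBD
  have hCC : C + C ≠ ∞ := by finiteness
  have h1 : ∀ m, formOnL0 q (f ⊓ u m) ≤ C + C := fun m =>
    le_of_dominated hq hclosed
      (mem_Lp_of_formOnL0_ne_top (ne_top_of_le_ne_top hC (huC m)))
      (fun n => ae_abs_inf_le (hu0 n) (hu0 m)) (hu.inf (aetendsto_const (u m))) hCC fun n =>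
      le_self_add.trans ((hQ.inf_add_sup_le hB _ _).trans (add_le_add (huC n) (huC m)))
  have hlim : AETendsto (fun m => u m ⊓ f) f := by
    simpa using hu.inf (aetendsto_const f)
  refine ne_top_of_le_ne_top hCC (le_of_dominated hq hclosed hf
    (fun m => ae_abs_inf_le (hu0 m) hf0) hlim hCC fun m => ?_)
  rw [inf_comm]
  exact h1 m

/-- A closed form on `L²` satisfying the first Beurling–Deny criterion is lower semicontinuous with
respect to almost everywhere convergence. -/
theorem formOnL0_le_of_aetendsto (hq : IsQuadForm q) (hclosed : IsClosedForm normL2 q)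
    (hBD : FirstBeurlingDeny q) {u : ℕ → X →ₘ[μ] ℝ} {f : X →ₘ[μ] ℝ} (hf : f ∈ Lp ℝ 2 μ)
    (hu : AETendsto u f) {C : ℝ≥0∞} (hC : C ≠ ∞) (huC : ∀ n, formOnL0 q (u n) ≤ C) :
    formOnL0 q f ≤ C := by
  have hQ := isQuadForm_formOnL0 hq
  have hB := firstBeurlingDeny_formOnL0 hBD
  have hff : formOnL0 q f ≠ ∞ := by
    have h1 := formOnL0_ne_top_of_nonneg hq hclosed hBD (f := f⁺)
      (show f ⊔ 0 ∈ Lp ℝ 2 μ from ((⟨f, hf⟩ : Lp ℝ 2 μ) ⊔ 0).2) (fun n => posPart_nonneg (u n))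
      (posPart_nonneg f) hu.posPart hC fun n => (hQ.posPart_le hB _).trans (huC n)
    have h2 := formOnL0_ne_top_of_nonneg hq hclosed hBD (f := f⁻)
      (show -f ⊔ 0 ∈ Lp ℝ 2 μ from (-(⟨f, hf⟩ : Lp ℝ 2 μ) ⊔ 0).2) (fun n => negPart_nonneg (u n))
      (negPart_nonneg f) hu.negPart hC fun n => (hQ.negPart_le hB _).trans (huC n)
    have h3 := hQ.sub_ne_top h1 h2
    rwa [posPart_sub_negPart] at h3
  have hz : AETendsto (fun n => u n - f) 0 := by
    simpa using hu.sub (aetendsto_const f)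
  have hD : 2 * C + 2 * formOnL0 q f ≠ ∞ := by finiteness
  have hzD : ∀ n, formOnL0 q (u n - f) ≤ 2 * C + 2 * formOnL0 q f := fun n =>
    (hQ.sub_le _ _).trans (by gcongr; exact huC n)
  have hzp : ∀ n, formOnL0 q (u n - f)⁺ ≤ 2 * C + 2 * formOnL0 q f := fun n =>
    (hQ.posPart_le hB _).trans (hzD n)
  have hzm : ∀ n, formOnL0 q (u n - f)⁻ ≤ 2 * C + 2 * formOnL0 q f := fun n =>
    (hQ.negPart_le hB _).trans (hzD n)
  have hp := tendsto_formPolar_of_nonneg hq hclosed hBD (fun n => posPart_nonneg (u n - f))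
    (by simpa using hz.posPart) hD hzp hff
  have hm := tendsto_formPolar_of_nonneg hq hclosed hBD (fun n => negPart_nonneg (u n - f))
    (by simpa using hz.negPart) hD hzm hff
  have hlim : Tendsto (fun n => (formOnL0 q f).toReal + 2 * formPolar (formOnL0 q) f (u n - f))
      atTop (𝓝 (formOnL0 q f).toReal) := by
    have h1 := ((hp.sub hm).const_mul 2).const_add (formOnL0 q f).toReal
    simp only [sub_zero, mul_zero, add_zero] at h1
    refine h1.congr fun n => ?_
    rw [← hQ.formPolar_sub_right hff (ne_top_of_le_ne_top hD (hzp n))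
      (ne_top_of_le_ne_top hD (hzm n)), posPart_sub_negPart]
  rw [← ENNReal.toReal_le_toReal hff hC]
  -- In `q (u n) = q f + 2 q(f, u n - f) + q (u n - f)` the last term is dropped and the middle one
  -- tends to zero.
  refine le_of_tendsto' hlim fun n => ?_
  have h1 := toReal_form_add (formOnL0 q) f (u n - f)
  rw [add_sub_cancel] at h1
  have h2 := ENNReal.toReal_mono hC (huC n)
  have h3 : 0 ≤ (formOnL0 q (u n - f)).toReal := ENNReal.toReal_nonneg
  linarith

end Lsc

/-! ### The lower semicontinuous envelope of a form -/

section Envelope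

variable {E : Type*} [AddCommGroup E] {N q : E → ℝ≥0∞}

/-- The lower semicontinuous envelope of `q` with respect to the metric `N (f - g)`. -/
noncomputable def lscEnvelope (N q : E → ℝ≥0∞) (f : E) : ℝ≥0∞ :=
  ⨆ ε : ℝ≥0∞, ⨆ _ : 0 < ε, ⨅ g : E, ⨅ _ : N (g - f) < ε, q g

theorem tendsto_add_inv_nat (c : ℝ≥0∞) :
    Tendsto (fun n : ℕ => c + ((n : ℝ≥0∞) + 1)⁻¹) atTop (𝓝 c) := by
  have := (tendsto_add_atTop_iff_nat 1).2 ENNReal.tendsto_inv_nat_nhds_zero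
  simpa using this.const_add c

theorem lscEnvelope_le_self (hN : IsFNorm N) (f : E) : lscEnvelope N q f ≤ q f :=
  iSup₂_le fun ε hε => iInf₂_le f (by rwa [sub_self, hN.map_zero])

theorem exists_seq_lscEnvelope {f : E} (hf : lscEnvelope N q f ≠ ∞) :
    ∃ u : ℕ → E, Tendsto (fun n => N (u n - f)) atTop (𝓝 0) ∧
      ∀ n : ℕ, q (u n) ≤ lscEnvelope N q f + ((n : ℝ≥0∞) + 1)⁻¹ := by
  have hex : ∀ n : ℕ, ∃ g : E, N (g - f) < ((n : ℝ≥0∞) + 1)⁻¹ ∧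
      q g < lscEnvelope N q f + ((n : ℝ≥0∞) + 1)⁻¹ := fun n => by
    have h1 : (⨅ g : E, ⨅ _ : N (g - f) < ((n : ℝ≥0∞) + 1)⁻¹, q g) ≤ lscEnvelope N q f :=
      le_iSup₂ (f := fun (ε : ℝ≥0∞) (_ : 0 < ε) => ⨅ g : E, ⨅ _ : N (g - f) < ε, q g) _ (by simp)
    have h2 := h1.trans_lt (ENNReal.lt_add_right (b := ((n : ℝ≥0∞) + 1)⁻¹) hf (by simp))
    obtain ⟨g, hg⟩ := iInf_lt_iff.1 h2
    obtain ⟨h3, h4⟩ := iInf_lt_iff.1 hg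
    exact ⟨g, h3, h4⟩
  choose u hu hq using hex
  refine ⟨u, ?_, fun n => (hq n).le⟩
  refine tendsto_of_tendsto_of_tendsto_of_le_of_le tendsto_const_nhds
    (by simpa using tendsto_add_inv_nat 0) (fun _ => zero_le) fun n => (hu n).le

theorem eventually_lt_of_lt_lscEnvelope {u : ℕ → E} {f : E}
    (hu : Tendsto (fun n => N (u n - f)) atTop (𝓝 0)) {a : ℝ≥0∞} (ha : a < lscEnvelope N q f) :
    ∀ᶠ n in atTop, a < q (u n) := by
  obtain ⟨ε, h⟩ := lt_iSup_iff.1 ha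
  obtain ⟨hε, h⟩ := lt_iSup_iff.1 h
  filter_upwards [hu.eventually_lt_const hε] with n hn
  exact h.trans_le (iInf₂_le (u n) hn)

/-- The bound may vary with `n`, so recovery sequences from `exists_seq_lscEnvelope` apply directly.
-/
theorem lscEnvelope_le_of_tendsto {u : ℕ → E} {f : E}
    (hu : Tendsto (fun n => N (u n - f)) atTop (𝓝 0)) {C : ℕ → ℝ≥0∞} {c : ℝ≥0∞}
    (hC : Tendsto C atTop (𝓝 c)) (huC : ∀ n, q (u n) ≤ C n) : lscEnvelope N q f ≤ c :=
  le_of_forall_lt fun _ ha => by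
    obtain ⟨b, hab, hb⟩ := exists_between ha
    refine hab.trans_le (ge_of_tendsto hC ?_)
    filter_upwards [eventually_lt_of_lt_lscEnvelope hu hb] with n hn
    exact hn.le.trans (huC n)

/-- The lower semicontinuous envelope is lower semicontinuous. -/
theorem lscEnvelope_le_of_eventually_le (hN : IsFNorm N) {u : ℕ → E} {f : E}
    (hu : Tendsto (fun n => N (u n - f)) atTop (𝓝 0)) {c : ℝ≥0∞}
    (huc : ∀ᶠ n in atTop, lscEnvelope N q (u n) ≤ c) : lscEnvelope N q f ≤ c := by
  refine iSup₂_le fun ε hε => ?_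
  have hε2 : 0 < ε / 2 := ENNReal.half_pos hε.ne'
  obtain ⟨n, hn, hnc⟩ := ((hu.eventually_lt_const hε2).and huc).exists
  refine le_trans ?_ hnc
  refine le_trans ?_ (le_iSup₂ (f := fun (ε : ℝ≥0∞) (_ : 0 < ε) =>
    ⨅ g : E, ⨅ _ : N (g - u n) < ε, q g) (ε / 2) hε2)
  refine le_iInf₂ fun g hg => iInf₂_le g ?_
  calc N (g - f) ≤ N (g - u n) + N (u n - f) := hN.sub_le _ _ _
    _ < ε / 2 + ε / 2 := ENNReal.add_lt_add hg hn
    _ = ε := ENNReal.add_halves ε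

variable [Module ℝ E]

/-- The lower semicontinuous envelope of a quadratic form is a quadratic form. -/
theorem IsQuadForm.lscEnvelope (hN : IsFNorm N)
    (hNs : ∀ c : ℝ, ∃ K : ℝ≥0∞, K ≠ ∞ ∧ ∀ f : E, N (c • f) ≤ K * N f) (hq : IsQuadForm q) :
    IsQuadForm (lscEnvelope N q) := by
  have hsmul : ∀ (c : ℝ) (f : E), c ≠ 0 →
      _root_.lscEnvelope N q (c • f) ≤ ENNReal.ofReal (c ^ 2) * _root_.lscEnvelope N q f := by
    intro c f hc
    by_cases hf : _root_.lscEnvelope N q f = ∞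
    · rw [hf, ENNReal.mul_top (by simpa using hc)]
      exact le_top
    obtain ⟨u, hu, huq⟩ := exists_seq_lscEnvelope hf
    obtain ⟨K, hK, hKN⟩ := hNs c
    refine lscEnvelope_le_of_tendsto (u := fun n => c • u n) ?_
      (ENNReal.Tendsto.const_mul (tendsto_add_inv_nat _) (Or.inr ENNReal.ofReal_ne_top))
      fun n => by rw [hq.smul]; gcongr; exact huq n
    refine tendsto_of_tendsto_of_tendsto_of_le_of_le tendsto_const_nhds
      (by simpa using ENNReal.Tendsto.const_mul hu (Or.inr hK)) (fun _ => zero_le) fun n => ?_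
    rw [← smul_sub]
    exact hKN _
  have hpar : ∀ f g : E, _root_.lscEnvelope N q (f + g) + _root_.lscEnvelope N q (f - g) ≤
      2 * _root_.lscEnvelope N q f + 2 * _root_.lscEnvelope N q g := by
    intro f g
    by_cases hf : _root_.lscEnvelope N q f = ∞
    · simp [hf]
    by_cases hg : _root_.lscEnvelope N q g = ∞
    · simp [hg]
    obtain ⟨u, hu, huq⟩ := exists_seq_lscEnvelope hf
    obtain ⟨v, hv, hvq⟩ := exists_seq_lscEnvelope hg
    have huv := hu.add hv
    rw [add_zero] at huv
    have hadd : Tendsto (fun n => N ((u n + v n) - (f + g))) atTop (𝓝 0) :=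
      tendsto_of_tendsto_of_tendsto_of_le_of_le tendsto_const_nhds huv (fun _ => zero_le)
        fun n => by
          rw [add_sub_add_comm]
          exact hN.add_le _ _
    have hsub : Tendsto (fun n => N ((u n - v n) - (f - g))) atTop (𝓝 0) :=
      tendsto_of_tendsto_of_tendsto_of_le_of_le tendsto_const_nhds huv (fun _ => zero_le)
        fun n => by
          rw [sub_sub_sub_comm, sub_eq_add_neg, ← hN.map_neg (v n - g)]
          exact hN.add_le _ _
    have hC : Tendsto (fun n : ℕ => 2 * (_root_.lscEnvelope N q f + ((n : ℝ≥0∞) + 1)⁻¹) +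
        2 * (_root_.lscEnvelope N q g + ((n : ℝ≥0∞) + 1)⁻¹)) atTop
        (𝓝 (2 * _root_.lscEnvelope N q f + 2 * _root_.lscEnvelope N q g)) :=
      (ENNReal.Tendsto.const_mul (tendsto_add_inv_nat _) (Or.inr (by norm_num))).add
        (ENNReal.Tendsto.const_mul (tendsto_add_inv_nat _) (Or.inr (by norm_num)))
    -- For fixed radii `ε` and `δ`, `u n + v n` and `u n - v n` eventually compete in the two
    -- infima.
    refine ENNReal.biSup_add_biSup_le' ⟨1, one_pos⟩ ⟨1, one_pos⟩ fun ε hε δ hδ =>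
      ge_of_tendsto hC ?_
    filter_upwards [hadd.eventually_lt_const hε, hsub.eventually_lt_const hδ] with n h1 h2
    calc _ ≤ q (u n + v n) + q (u n - v n) :=
        add_le_add (iInf₂_le (u n + v n) h1) (iInf₂_le (u n - v n) h2)
      _ = 2 * q (u n) + 2 * q (v n) := hq.parallelogram _ _
      _ ≤ _ := by
        gcongr
        · exact huq n
        · exact hvq n
  have hsmul_eq : ∀ (c : ℝ) (f : E), _root_.lscEnvelope N q (c • f) =
      ENNReal.ofReal (c ^ 2) * _root_.lscEnvelope N q f := by
    intro c f
    rcases eq_or_ne c 0 with rfl | hc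
    · have h := lscEnvelope_le_self (q := q) hN 0
      rw [hq.map_zero, le_zero_iff] at h
      simp [h]
    refine le_antisymm (hsmul c f hc) ?_
    have h := hsmul c⁻¹ (c • f) (inv_ne_zero hc)
    rw [smul_smul, inv_mul_cancel₀ hc, one_smul] at h
    calc ENNReal.ofReal (c ^ 2) * _root_.lscEnvelope N q f
        ≤ ENNReal.ofReal (c ^ 2) *
          (ENNReal.ofReal (c⁻¹ ^ 2) * _root_.lscEnvelope N q (c • f)) := by gcongr
      _ = _root_.lscEnvelope N q (c • f) := by
        rw [← mul_assoc, ← ENNReal.ofReal_mul (sq_nonneg c), ← mul_pow, mul_inv_cancel₀ hc]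
        simp
  refine ⟨hsmul_eq, fun f g => le_antisymm (hpar f g) ?_⟩
  -- The reverse inequality is the same one for `f + g` and `f - g`, whose sum and difference are `2
  -- f` and `2 g`.
  have h := hpar (f + g) (f - g)
  rw [add_add_sub_cancel, add_sub_sub_cancel, ← two_smul ℝ f, ← two_smul ℝ g, hsmul_eq, hsmul_eq,
    ← mul_add, ← mul_add, show ENNReal.ofReal (2 ^ 2) = 2 * 2 by
      rw [ENNReal.ofReal_pow (by norm_num)]; norm_num, mul_assoc] at h
  rw [← mul_add]
  exact (ENNReal.mul_le_mul_iff_right (by norm_num) (by norm_num)).1 h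

/-- The lower semicontinuous envelope of a quadratic form on a complete space is closed. -/
theorem isClosedForm_lscEnvelope (hN : IsFNorm N)
    (hcomp : ∀ u : ℕ → E,
      (∀ ε : ℝ≥0∞, 0 < ε → ∃ K : ℕ, ∀ m ≥ K, ∀ n ≥ K, N (u m - u n) < ε) →
      ∃ f : E, Tendsto (fun n => N (u n - f)) atTop (𝓝 0))
    (hqe : IsQuadForm (lscEnvelope N q)) : IsClosedForm N (lscEnvelope N q) := by
  intro u hu hcau
  obtain ⟨f, hf⟩ := hcomp u fun ε hε => by
    obtain ⟨K, hK⟩ := hcau ε hε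
    exact ⟨K, fun m hm n hn => le_add_self.trans_lt (hK m hm n hn)⟩
  have hle : ∀ ε : ℝ≥0∞, 0 < ε →
      ∃ K : ℕ, ∀ n ≥ K, lscEnvelope N q (u n - f) ^ (1 / 2 : ℝ) ≤ ε := by
    intro ε hε
    obtain ⟨K, hK⟩ := hcau ε hε
    refine ⟨K, fun n hn => ?_⟩
    have h1 : lscEnvelope N q (u n - f) ≤ ε ^ (2 : ℝ) := by
      -- The Cauchy bound on `u n - u m` passes to `u n - f` as `m → ∞` by lower semicontinuity of
      -- the envelope.
      refine lscEnvelope_le_of_eventually_le hN (u := fun m => u n - u m) ?_ ?_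
      · refine hf.congr fun m => ?_
        rw [sub_sub_sub_cancel_left, hN.map_sub_comm]
      · filter_upwards [eventually_ge_atTop K] with m hm
        have h2 : lscEnvelope N q (u n - u m) ^ (1 / 2 : ℝ) ≤ ε :=
          le_self_add.trans (hK n hn m hm).le
        have h3 := ENNReal.rpow_le_rpow h2 (show (0 : ℝ) ≤ 2 by norm_num)
        rw [← ENNReal.rpow_mul] at h3
        simpa using h3
    have h4 := ENNReal.rpow_le_rpow h1 (show (0 : ℝ) ≤ 1 / 2 by norm_num)
    rw [← ENNReal.rpow_mul] at h4
    simpa using h4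
  have hlim : Tendsto (fun n => lscEnvelope N q (u n - f) ^ (1 / 2 : ℝ)) atTop (𝓝 0) :=
    ENNReal.tendsto_nhds_zero.2 fun ε hε => eventually_atTop.2 (hle ε hε)
  refine ⟨f, ?_, by simpa [formDist] using hlim.add hf⟩
  obtain ⟨K, hK⟩ := hle 1 one_pos
  have h1 : lscEnvelope N q (u K - f) ≠ ∞ := fun h => by
    have := hK K le_rfl
    rw [h] at this
    simp at this
  have h2 := hqe.sub_ne_top (hu K).ne h1
  rw [sub_sub_cancel] at h2
  exact h2.lt_top

end Envelope

/-! ### The extended form -/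

section Extended

variable {X : Type*} [MeasurableSpace X] {μ : Measure X} {φ : X → ℝ} {q : Lp ℝ 2 μ → ℝ≥0∞}

theorem exists_aetendsto_lscEnvelope (hφ : Integrable φ μ) (hφpos : ∀ x, 0 < φ x)
    {Q : (X →ₘ[μ] ℝ) → ℝ≥0∞} {f : X →ₘ[μ] ℝ} (hf : lscEnvelope (normL0 φ) Q f ≠ ∞) :
    ∃ v : ℕ → X →ₘ[μ] ℝ, AETendsto v f ∧
      ∀ n : ℕ, Q (v n) ≤ lscEnvelope (normL0 φ) Q f + ((n : ℝ≥0∞) + 1)⁻¹ := by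
  obtain ⟨u, hu, huq⟩ := exists_seq_lscEnvelope hf
  obtain ⟨ns, hns, hae⟩ := exists_subseq_aetendsto hφ hφpos hu
  refine ⟨fun k => u (ns k), hae, fun k => (huq (ns k)).trans ?_⟩
  gcongr
  exact hns.id_le k

theorem isQuadForm_lscEnvelope_normL0 (hφ : Integrable φ μ) (hφpos : ∀ x, 0 < φ x)
    {Q : (X →ₘ[μ] ℝ) → ℝ≥0∞} (hQ : IsQuadForm Q) : IsQuadForm (lscEnvelope (normL0 φ) Q) :=
  hQ.lscEnvelope (isFNorm_normL0 hφ hφpos) fun c =>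
    ⟨_, ENNReal.ofReal_ne_top, normL0_smul_le hφ hφpos c⟩

theorem isClosedForm_lscEnvelope_normL0 (hφ : Integrable φ μ) (hφpos : ∀ x, 0 < φ x)
    {Q : (X →ₘ[μ] ℝ) → ℝ≥0∞} (hQ : IsQuadForm Q) :
    IsClosedForm (normL0 φ) (lscEnvelope (normL0 φ) Q) :=
  isClosedForm_lscEnvelope (isFNorm_normL0 hφ hφpos)
    (fun _ => exists_tendsto_normL0_of_cauchy hφ hφpos)
    (isQuadForm_lscEnvelope_normL0 hφ hφpos hQ)

/-- Lower semicontinuity applied to an a.e. convergent recovery sequence. Only `f ∈ L²` is assumed,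
not `q f < ∞`; this is what makes the extended domain meet `L²` exactly in `D(q)`. -/
theorem lscEnvelope_formOnL0_of_mem (hφ : Integrable φ μ) (hφpos : ∀ x, 0 < φ x)
    (hq : IsQuadForm q) (hclosed : IsClosedForm normL2 q) (hBD : FirstBeurlingDeny q)
    {f : X →ₘ[μ] ℝ} (hf : f ∈ Lp ℝ 2 μ) :
    lscEnvelope (normL0 φ) (formOnL0 q) f = formOnL0 q f := by
  refine le_antisymm (lscEnvelope_le_self (isFNorm_normL0 hφ hφpos) f) ?_
  by_cases hfin : lscEnvelope (normL0 φ) (formOnL0 q) f = ∞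
  · rw [hfin]
    exact le_top
  obtain ⟨v, hv, hvq⟩ := exists_aetendsto_lscEnvelope hφ hφpos hfin
  -- The tail from index `m` on has the constant bound that lower semicontinuity requires.
  refine ge_of_tendsto' (tendsto_add_inv_nat _) fun m =>
    formOnL0_le_of_aetendsto hq hclosed hBD hf (hv.subseq (tendsto_add_atTop_nat m))
      (by finiteness) fun n => (hvq _).trans ?_
  gcongr
  omega

theorem isClosedFormExtension_lscEnvelope (hφ : Integrable φ μ) (hφpos : ∀ x, 0 < φ x)
    (hq : IsQuadForm q) (hclosed : IsClosedForm normL2 q) (hBD : FirstBeurlingDeny q) :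
    IsClosedFormExtension (normL0 φ) (formOnL0 q) (lscEnvelope (normL0 φ) (formOnL0 q)) where
  isQuadForm := isQuadForm_lscEnvelope_normL0 hφ hφpos (isQuadForm_formOnL0 hq)
  isClosedForm := isClosedForm_lscEnvelope_normL0 hφ hφpos (isQuadForm_formOnL0 hq)
  isFormExtension := by
    have h : ∀ f ∈ formDomain (formOnL0 q),
        lscEnvelope (normL0 φ) (formOnL0 q) f = formOnL0 q f := fun f hf =>
      lscEnvelope_formOnL0_of_mem hφ hφpos hq hclosed hBD (mem_Lp_of_formOnL0_ne_top (ne_of_lt hf))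
    exact ⟨fun f hf => (h f hf).trans_lt hf, h⟩

/-- The limit depends only on `Q` and the sequence, so all closed extensions agree at `f`. -/
theorem IsClosedFormExtension.tendsto_of_cauchy {E : Type*} [AddCommGroup E] [Module ℝ E]
    {N Q Q' : E → ℝ≥0∞} (hext : IsClosedFormExtension N Q Q') (hN : IsFNorm N) (hQ : IsQuadForm Q)
    {u : ℕ → E} (hu : ∀ n, Q (u n) ≠ ∞)
    (hcau : ∀ ε : ℝ≥0∞, 0 < ε → ∃ M : ℕ, ∀ m ≥ M, ∀ n ≥ M, Q (u m - u n) < ε) {f : E}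
    (hf : Tendsto (fun n => N (u n - f)) atTop (𝓝 0)) :
    Q' f ≠ ∞ ∧ Tendsto (fun n => Q (u n) ^ (1 / 2 : ℝ)) atTop (𝓝 (Q' f ^ (1 / 2 : ℝ))) := by
  have heq : ∀ g, Q g ≠ ∞ → Q' g = Q g := fun g hg => hext.isFormExtension.2 hg.lt_top
  have h := hext.isClosedForm.tendsto_of_cauchy hN (u := u) (fun n => (heq _ (hu n)).symm ▸ hu n)
    (fun ε hε => by
      obtain ⟨M, hM⟩ := hcau ε hε
      refine ⟨M, fun m hm n hn => ?_⟩
      rw [heq _ (hQ.sub_ne_top (hu m) (hu n))]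
      exact hM m hm n hn) hf
  refine ⟨h.1, (hext.isQuadForm.tendsto_sqrt h.2).congr fun n => ?_⟩
  rw [heq _ (hu n)]

/-- A form is recovered from its lower semicontinuous envelope along Cauchy sequences. -/
theorem exists_cauchy_aetendsto {Q : (X →ₘ[μ] ℝ) → ℝ≥0∞} (hφ : Integrable φ μ)
    (hφpos : ∀ x, 0 < φ x) (hQ : IsQuadForm Q) {f : X →ₘ[μ] ℝ}
    (hf : lscEnvelope (normL0 φ) Q f ≠ ∞) :
    ∃ g : ℕ → X →ₘ[μ] ℝ, AETendsto g f ∧ (∀ n, Q (g n) ≠ ∞) ∧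
      ∀ ε : ℝ≥0∞, 0 < ε → ∃ M : ℕ, ∀ m ≥ M, ∀ n ≥ M, Q (g m - g n) < ε := by
  obtain ⟨v, hv, hvq⟩ := exists_aetendsto_lscEnvelope hφ hφpos hf
  obtain ⟨g, hgK, hgC, hcau⟩ := hQ.exists_cauchy_of_midpoint
    -- Balls of `normL0` need not be midpoint-closed, since `min |·| 1` is not convex. Pointwise
    -- bounds by the tail suprema of `|v n - f|` are, and they force a.e. convergence to `f`.
    (K := fun k => {g | ∀ᵐ x ∂μ, ‖g x - f x‖ₑ ≤ ⨆ n ≥ k, ‖v n x - f x‖ₑ})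
    (fun a b hab g hg => by
      change ∀ᵐ x ∂μ, _
      filter_upwards [show ∀ᵐ x ∂μ, ‖g x - f x‖ₑ ≤ ⨆ n ≥ b, ‖v n x - f x‖ₑ from hg] with x hx
      exact hx.trans (biSup_mono fun n hn => hab.trans hn))
    (fun k a ha b hb => by
      change ∀ᵐ x ∂μ, _
      filter_upwards [ha, hb, AEEqFun.coeFn_smul (1 / 2 : ℝ) (a + b), AEEqFun.coeFn_add a b]
        with x h1 h2 h3 h4
      rw [h3, Pi.smul_apply, h4, Pi.add_apply, smul_eq_mul]
      have hconv : |1 / 2 * (a x + b x) - f x| ≤ max |a x - f x| |b x - f x| := by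
        have h5 := abs_add_le (1 / 2 * (a x - f x)) (1 / 2 * (b x - f x))
        rw [abs_mul, abs_mul, abs_of_pos (show (0 : ℝ) < 1 / 2 by norm_num)] at h5
        have h6 := le_max_left |a x - f x| |b x - f x|
        have h7 := le_max_right |a x - f x| |b x - f x|
        rw [show 1 / 2 * (a x + b x) - f x =
          1 / 2 * (a x - f x) + 1 / 2 * (b x - f x) by ring]
        linarith
      rcases le_max_iff.1 hconv with h | h
      · exact (enorm_le_iff_norm_le.2 h).trans h1
      · exact (enorm_le_iff_norm_le.2 h).trans h2)
    hf fun k ε hε => by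
      obtain ⟨n, hn, hnk⟩ := (((tendsto_add_inv_nat 0).eventually_lt_const hε).and
        (eventually_ge_atTop k)).exists
      refine ⟨v n, ae_of_all μ fun x =>
        le_iSup₂ (f := fun n (_ : n ≥ k) => ‖v n x - f x‖ₑ) n hnk, (hvq n).trans ?_⟩
      rw [zero_add] at hn
      gcongr
  refine ⟨g, ?_, fun n => ne_top_of_le_ne_top (by finiteness) (hgC n), hcau⟩
  filter_upwards [hv, ae_all_iff.2 hgK] with x h1 h2
  have h3 : Tendsto (fun n => ‖v n x - f x‖ₑ) atTop (𝓝 0) := by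
    simpa using (h1.sub_const (f x)).enorm
  refine tendsto_iff_edist_tendsto_0.2 (ENNReal.tendsto_nhds_zero.2 fun ε hε => ?_)
  obtain ⟨K, hK⟩ := eventually_atTop.1 (ENNReal.tendsto_nhds_zero.1 h3 ε hε)
  filter_upwards [eventually_ge_atTop K] with k hk
  rw [edist_eq_enorm_sub]
  exact (h2 k).trans (iSup₂_le fun n hn => hK n (hk.trans hn))

theorem isFormClosure_lscEnvelope (hφ : Integrable φ μ) (hφpos : ∀ x, 0 < φ x)
    (hq : IsQuadForm q) (hclosed : IsClosedForm normL2 q) (hBD : FirstBeurlingDeny q) :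
    IsFormClosure (normL0 φ) (formOnL0 q) (lscEnvelope (normL0 φ) (formOnL0 q)) where
  isClosedFormExtension := isClosedFormExtension_lscEnvelope hφ hφpos hq hclosed hBD
  smallest q' hq' := by
    have hN := isFNorm_normL0 (μ := μ) hφ hφpos
    have hQ := isQuadForm_formOnL0 hq
    have key : ∀ f ∈ formDomain (lscEnvelope (normL0 φ) (formOnL0 q)),
        q' f ≠ ∞ ∧ q' f = lscEnvelope (normL0 φ) (formOnL0 q) f := fun f hf => by
      obtain ⟨g, hg, hgfin, hcau⟩ := exists_cauchy_aetendsto hφ hφpos hQ (ne_of_lt hf)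
      have hgN := hg.tendsto_normL0 hφ hφpos
      have h1 := hq'.tendsto_of_cauchy hN hQ hgfin hcau hgN
      have h2 := (isClosedFormExtension_lscEnvelope hφ hφpos hq hclosed hBD).tendsto_of_cauchy
        hN hQ hgfin hcau hgN
      exact ⟨h1.1, ENNReal.rpow_left_injective (show (1 / 2 : ℝ) ≠ 0 by norm_num)
        (tendsto_nhds_unique h1.2 h2.2)⟩
    exact ⟨fun f hf => (key f hf).1.lt_top, fun f hf => (key f hf).2⟩

/-- Contractions of the underlying space that do not increase a form do not increase its
lower semicontinuous envelope. -/
theorem lscEnvelope_comp_le (hφpos : ∀ x, 0 < φ x) {Q : (X →ₘ[μ] ℝ) → ℝ≥0∞}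
    {T : (X →ₘ[μ] ℝ) → X →ₘ[μ] ℝ} (hT : ∀ f g, ∀ᵐ x ∂μ, |T f x - T g x| ≤ |f x - g x|)
    (hQ : ∀ f, Q (T f) ≤ Q f) (f : X →ₘ[μ] ℝ) :
    lscEnvelope (normL0 φ) Q (T f) ≤ lscEnvelope (normL0 φ) Q f := by
  by_cases hf : lscEnvelope (normL0 φ) Q f = ∞
  · rw [hf]
    exact le_top
  obtain ⟨u, hu, huq⟩ := exists_seq_lscEnvelope hf
  -- The contraction property makes `T (u n)` converge to `T f`, so it is an admissible sequence
  -- there.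
  refine lscEnvelope_le_of_tendsto (u := fun n => T (u n)) ?_ (tendsto_add_inv_nat _)
    fun n => (hQ _).trans (huq n)
  refine tendsto_of_tendsto_of_tendsto_of_le_of_le tendsto_const_nhds hu (fun _ => zero_le)
    fun n => normL0_mono hφpos ?_
  filter_upwards [hT (u n) f, AEEqFun.coeFn_sub (u n) f, AEEqFun.coeFn_sub (T (u n)) (T f)]
    with x h1 h2 h3
  rwa [h2, h3, Pi.sub_apply, Pi.sub_apply]

theorem firstBeurlingDeny_lscEnvelope (hφpos : ∀ x, 0 < φ x) {Q : (X →ₘ[μ] ℝ) → ℝ≥0∞}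
    (hQ : FirstBeurlingDeny Q) : FirstBeurlingDeny (lscEnvelope (normL0 φ) Q) :=
  lscEnvelope_comp_le hφpos (fun f g => by
    filter_upwards [AEEqFun.coeFn_abs f, AEEqFun.coeFn_abs g] with x h1 h2
    rw [h1, h2]
    exact abs_abs_sub_abs_le _ _) hQ

theorem isExcessiveL0_lscEnvelope (hφpos : ∀ x, 0 < φ x) {Q : (X →ₘ[μ] ℝ) → ℝ≥0∞}
    {h : X →ₘ[μ] ℝ} (hQ : IsExcessiveL0 Q h) : IsExcessiveL0 (lscEnvelope (normL0 φ) Q) h :=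
  lscEnvelope_comp_le hφpos (fun f g => by
    filter_upwards [AEEqFun.coeFn_inf f h, AEEqFun.coeFn_inf g h] with x h1 h2
    rw [h1, h2]
    simpa using abs_inf_sub_inf_le_abs (f x) (g x) (h x)) hQ

theorem negPart_mem_Lp_of_nonneg {h : X →ₘ[μ] ℝ} (hh : 0 ≤ h) : h⁻ ∈ Lp ℝ 2 μ := by
  rw [negPart_of_nonneg hh]
  exact zero_mem _

theorem isExcessiveL2_iff_formOnL0 {h : X →ₘ[μ] ℝ} (hh : 0 ≤ h) :
    IsExcessiveL2 q h ↔ ∀ f ∈ Lp ℝ 2 μ, formOnL0 q (f ⊓ h) ≤ formOnL0 q f := by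
  refine ⟨fun ⟨hh2, hex⟩ f hf => ?_, fun hex => ⟨negPart_mem_Lp_of_nonneg hh, fun f => ?_⟩⟩
  · lift f to Lp ℝ 2 μ using hf
    have := hex f
    rwa [← formOnL0_coe q, ← formOnL0_coe q] at this
  · rw [← formOnL0_coe q, ← formOnL0_coe q]
    exact hex f f.2

end Extended

theorem mainTheorem6 {X : Type*} [MeasurableSpace X] (μ : Measure X) [SigmaFinite μ]
    (φ : X → ℝ) (hφ : Integrable φ μ) (hφpos : ∀ x, 0 < φ x)
    (q : Lp ℝ 2 μ → ℝ≥0∞) (hq : IsQuadForm q) (hclosed : IsClosedForm normL2 q)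
    (hBD : FirstBeurlingDeny q) :
    IsClosableForm (normL0 φ) (formOnL0 q) ∧
    ∃ qe : (X →ₘ[μ] ℝ) → ℝ≥0∞,
      IsFormClosure (normL0 φ) (formOnL0 q) qe ∧
      FirstBeurlingDeny qe ∧
      formDomain qe ∩ {f | f ∈ Lp ℝ 2 μ} =
        (fun f : Lp ℝ 2 μ => (f : X →ₘ[μ] ℝ)) '' formDomain q ∧
      ∀ h : X →ₘ[μ] ℝ, 0 ≤ h → (IsExcessiveL2 q h ↔ IsExcessiveL0 qe h) := by
  have heq : ∀ f ∈ Lp ℝ 2 μ, lscEnvelope (normL0 φ) (formOnL0 q) f = formOnL0 q f := fun f hf =>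
    lscEnvelope_formOnL0_of_mem hφ hφpos hq hclosed hBD hf
  refine ⟨⟨_, isClosedFormExtension_lscEnvelope hφ hφpos hq hclosed hBD⟩,
    lscEnvelope (normL0 φ) (formOnL0 q), isFormClosure_lscEnvelope hφ hφpos hq hclosed hBD,
    firstBeurlingDeny_lscEnvelope hφpos (firstBeurlingDeny_formOnL0 hBD), ?_, fun h hh => ?_⟩
  · ext f
    refine ⟨fun ⟨hf, hf2⟩ => ⟨⟨f, hf2⟩, ?_, rfl⟩, ?_⟩
    · have hlt : lscEnvelope (normL0 φ) (formOnL0 q) f < ∞ := hf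
      rw [heq f hf2] at hlt
      exact (formOnL0_coe q ⟨f, hf2⟩).symm.trans_lt hlt
    · rintro ⟨g, hg, rfl⟩
      refine ⟨?_, g.2⟩
      change lscEnvelope (normL0 φ) (formOnL0 q) (g : X →ₘ[μ] ℝ) < ∞
      rw [heq _ g.2, formOnL0_coe]
      exact hg
  · rw [isExcessiveL2_iff_formOnL0 hh]
    -- Excessivity on `L²` extends to `formOnL0 q` because its value off `L²` is `∞`. Conversely, `h
    -- ≥ 0` keeps `f ⊓ h` in `L²`, where the envelope equals `q`.
    refine ⟨fun hex => isExcessiveL0_lscEnvelope hφpos fun f => ?_, fun hex f hf => ?_⟩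
    · by_cases hf : f ∈ Lp ℝ 2 μ
      · exact hex f hf
      · rw [formOnL0_of_notMem hf]
        exact le_top
    · have := hex f
      rwa [heq _ hf, heq _ (inf_mem_L2 (negPart_mem_Lp_of_nonneg hh) ⟨f, hf⟩)] at this
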